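/- Let $\kappa\ge 0$ and $1<r<+\infty$. On $\mathbb R$ (dimension $d=1$, reflection group $\mathbb Z_2$, root system $\{\pm1\}$) put $d\mu_\kappa(y)=|y|^{2\kappa}\,dy$, $c_\kappa=\bigl(\int_{\mathbb R}e^{-y^2/2}\,d\mu_\kappa(y)\bigr)^{-1}$, and let $T_\kappa g(x)=g'(x)+\kappa\,\frac{g(x)-g(-x)}{x}$ be the Dunkl operator (the quotient being read as $2g'(0)$ at $x=0$). Let $E_\kappa$ be the Dunkl kernel: for $w\in\mathbb C$, $E_\kappa(\cdot,w)$ is the unique real-analytic solution on $\mathbb R$ of $T_\kappa g=wg$, $g(0)=1$, extended holomorphically to $\mathbb C\times\mathbb C$. Let $\mathcal F_\kappa$ be the Dunkl transform $\mathcal F_\kappa g(x)=c_\kappa\int_{\mathbb R}E_\kappa(-ix,y)g(y)\,d\mu_\kappa(y)$, extended from $L^1\cap L^2(\mu_\kappa)$ to $L^2(\mu_\kappa)$, and for $x\in\mathbb R$ let $\tau_x$ be the Dunkl translation on $L^2(\mu_\kappa)$, given by $\mathcal F_\kappa(\tau_xg)(y)=E_\kappa(ix,y)\,\mathcal F_\kappa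 g(y)$. With $B_\rho=\,]-\rho,\rho[$, the Dunkl maximal operator is $$M_\kappa g(x)=\sup_{\rho>0}\frac1{\mu_\kappa(B_\rho)}\left|\int_{\mathbb R}g(y)\,\tau_x(\chi_{B_\rho})(-y)\,d\mu_\kappa(y)\right|\in[0,+\infty],$$ and for a sequence $f=(f_n)_{n\ge1}$ put $\mathcal M_\kappa f=(M_\kappa f_n)_{n\ge1}$. The vector-valued maximal inequality for $M_\kappa$ fails for $p=+\infty$: there is no constant $C<+\infty$ such that $$\bigl\|\,\|\mathcal M_\kappa f\|_{\ell^r}\bigr\|_{L^\infty(\mu_\kappa)}\le C\,\bigl\|\,\|f\|_{\ell^r}\bigr\|_{L^\infty(\mu_\kappa)}$$ for all sequences $f=(f_n)_{n\ge1}$ of measurable functions with $\|f\|_{\ell^r}\in L^\infty(\mu_\kappa)$. More precisely, let $f_n=\chi_{[2^{n-1},2^n[}$ for $n\ge1$. Then $\|f(x)\|_{\ell^r}=\chi_{[1,+\infty[}(x)$ for every $x\in\mathbb R$, so that $\|f\|_{\ell^r}\in L^\infty(\mu_\kappa)$; for every $n\ge1$ and every $x$ with $|x|\le2^n$, $$M_\kappa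 f_n(x)\ \ge\ \frac{1-2^{-(2\kappa+1)}}{2^{2\kappa+2}}\ >0;$$ consequently $\|\mathcal M_\kappa f(x)\|_{\ell^r}=+\infty$ for every $x\in\mathbb R$, and $\bigl\|\,\|\mathcal M_\kappa f\|_{\ell^r}\bigr\|_{L^\infty(\mu_\kappa)}=+\infty$, so $\|\mathcal M_\kappa f\|_{\ell^r}\notin L^\infty(\mu_\kappa)$. -/

import Mathlib

open MeasureTheory Filter Set
open scoped ENNReal NNReal Topology

noncomputable section

namespace Dunkl

/-- The Dunkl operator on `ℝ` for the reflection group `ℤ₂` (root system `{±1}`) with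
multiplicity `κ`: `T f (x) = f'(x) + κ (f(x) - f(-x)) / x`. At `x = 0` the difference quotient
is read as its limit `2 f'(0)`. -/
def dunklOperator (κ : ℝ) (f : ℝ → ℂ) (x : ℝ) : ℂ :=
  if x = 0 then (1 + 2 * (κ : ℂ)) * deriv f 0
  else deriv f x + (κ : ℂ) * ((f x - f (-x)) / (x : ℂ))

/-- The generalized factorials: `T (x ^ n) = (γ n / γ (n - 1)) x ^ (n - 1)` with `γ 0 = 1`. -/
def dunklFactorial (κ : ℝ) : ℕ → ℝ
  | 0 => 1
  | n + 1 => ((n + 1 : ℝ) + κ * (1 - (-1) ^ (n + 1))) * dunklFactorial κ n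

/-- The Dunkl kernel `E(z, w) = ∑ (z w) ^ n / γ n` on `ℂ × ℂ`. It is holomorphic in both variables
(`differentiable_dunklKernel`), and for every `w` its restriction to real `z` is the unique
real-analytic solution of `T f = w f`, `f 0 = 1` (`isDunklEigenfunction_iff`). -/
def dunklKernel (κ : ℝ) (z w : ℂ) : ℂ :=
  ∑' n : ℕ, (z * w) ^ n / (dunklFactorial κ n : ℂ)

/-- `f` is a real-analytic solution of the Dunkl eigenvalue problem `T f = w f` with `f 0 = 1`. -/
def IsDunklEigenfunction (κ : ℝ) (w : ℂ) (f : ℝ → ℂ) : Prop :=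
  AnalyticOnNhd ℝ f univ ∧ f 0 = 1 ∧ ∀ x : ℝ, dunklOperator κ f x = w * f x

section KernelFacts

lemma one_sub_neg_one_pow_nonneg (n : ℕ) : (0 : ℝ) ≤ 1 - (-1) ^ n := by
  rcases neg_one_pow_eq_or ℝ n with h | h <;> rw [h] <;> norm_num

lemma factorial_le_dunklFactorial {κ : ℝ} (hκ : 0 ≤ κ) (n : ℕ) :
    (n.factorial : ℝ) ≤ dunklFactorial κ n := by
  induction n with
  | zero => simp [dunklFactorial]
  | succ k ih =>
    have h1 := mul_nonneg hκ (one_sub_neg_one_pow_nonneg (k + 1))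
    rw [dunklFactorial, Nat.factorial_succ]
    push_cast
    exact mul_le_mul (by linarith) ih (by positivity) (by positivity)

lemma dunklFactorial_pos {κ : ℝ} (hκ : 0 ≤ κ) (n : ℕ) : 0 < dunklFactorial κ n :=
  lt_of_lt_of_le (by exact_mod_cast n.factorial_pos) (factorial_le_dunklFactorial hκ n)

/-- The one-variable series `∑ z ^ n / γ n`. -/
def kernelSeries (κ : ℝ) (z : ℂ) : ℂ := ∑' n : ℕ, z ^ n / (dunklFactorial κ n : ℂ)

lemma norm_term_le {κ : ℝ} (hκ : 0 ≤ κ) {R : ℝ} {z : ℂ} (hz : ‖z‖ ≤ R) (n : ℕ) :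
    ‖z ^ n / (dunklFactorial κ n : ℂ)‖ ≤ R ^ n / n.factorial := by
  rw [norm_div, norm_pow, Complex.norm_real, Real.norm_of_nonneg (dunklFactorial_pos hκ n).le]
  have h0 : 0 ≤ R := (norm_nonneg z).trans hz
  have := factorial_le_dunklFactorial hκ n
  have h1 : (0 : ℝ) < n.factorial := by exact_mod_cast n.factorial_pos
  gcongr

lemma hasSum_kernelSeries {κ : ℝ} (hκ : 0 ≤ κ) (z : ℂ) :
    HasSum (fun n : ℕ => z ^ n / (dunklFactorial κ n : ℂ)) (kernelSeries κ z) :=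
  (Summable.of_norm_bounded (Real.summable_pow_div_factorial ‖z‖)
    (fun n => norm_term_le hκ le_rfl n)).hasSum

lemma differentiable_kernelSeries {κ : ℝ} (hκ : 0 ≤ κ) : Differentiable ℂ (kernelSeries κ) := by
  intro z
  have h := Complex.differentiableOn_tsum_of_summable_norm
    (F := fun (n : ℕ) (z : ℂ) => z ^ n / (dunklFactorial κ n : ℂ))
    (Real.summable_pow_div_factorial (‖z‖ + 1))
    (fun n => by fun_prop) Metric.isOpen_ball
    (fun n w (hw : w ∈ Metric.ball (0 : ℂ) (‖z‖ + 1)) =>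
      norm_term_le hκ (by simpa using (mem_ball_zero_iff.mp hw).le) n)
  exact h.differentiableAt (Metric.isOpen_ball.mem_nhds (by simp))

lemma hasSum_deriv_kernelSeries {κ : ℝ} (hκ : 0 ≤ κ) (z : ℂ) :
    HasSum (fun n : ℕ => (n : ℂ) * z ^ (n - 1) / (dunklFactorial κ n : ℂ))
      (deriv (kernelSeries κ) z) := by
  have h := Complex.hasSum_deriv_of_summable_norm
    (F := fun (n : ℕ) (z : ℂ) => z ^ n / (dunklFactorial κ n : ℂ))
    (Real.summable_pow_div_factorial (‖z‖ + 1))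
    (fun n => by fun_prop) Metric.isOpen_ball
    (fun n w (hw : w ∈ Metric.ball (0 : ℂ) (‖z‖ + 1)) =>
      norm_term_le hκ (by simpa using (mem_ball_zero_iff.mp hw).le) n) (z := z) (by simp)
  have e : (fun n : ℕ => deriv (fun z : ℂ => z ^ n / (dunklFactorial κ n : ℂ)) z)
      = fun n : ℕ => (n : ℂ) * z ^ (n - 1) / (dunklFactorial κ n : ℂ) := by
    funext n
    simp
  rw [← e]
  exact h

lemma deriv_kernelSeries_zero {κ : ℝ} (hκ : 0 ≤ κ) :
    (1 + 2 * (κ : ℂ)) * deriv (kernelSeries κ) 0 = 1 := by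
  have h := (hasSum_deriv_kernelSeries hκ 0).unique (hasSum_single 1 (by
    intro n hn
    rcases n with _ | _ | n
    · simp
    · exact absurd rfl hn
    · simp))
  have hne : (1 + 2 * (κ : ℂ)) ≠ 0 := by
    have : (1 + 2 * κ : ℝ) ≠ 0 := by positivity
    exact_mod_cast this
  rw [h]
  have e : (dunklFactorial κ 1 : ℂ) = 1 + 2 * (κ : ℂ) := by
    simp [dunklFactorial]
    ring
  rw [e]
  simp [hne]

lemma kernelSeries_eq {κ : ℝ} (hκ : 0 ≤ κ) (z : ℂ) :
    z * deriv (kernelSeries κ) z + (κ : ℂ) * (kernelSeries κ z - kernelSeries κ (-z))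
      = z * kernelSeries κ z := by
  have h1 := ((hasSum_deriv_kernelSeries hκ z).mul_left z).add
    (((hasSum_kernelSeries hκ z).sub (hasSum_kernelSeries hκ (-z))).mul_left (κ : ℂ))
  have h2 := (hasSum_kernelSeries hκ z).mul_left z
  have h3 := (hasSum_nat_add_iff' 1).mpr h1
  have e : (fun n : ℕ => z * (z ^ n / (dunklFactorial κ n : ℂ))) = fun n : ℕ =>
      z * (((n + 1 : ℕ) : ℂ) * z ^ (n + 1 - 1) / (dunklFactorial κ (n + 1) : ℂ)) +
        (κ : ℂ) * (z ^ (n + 1) / (dunklFactorial κ (n + 1) : ℂ) -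
          (-z) ^ (n + 1) / (dunklFactorial κ (n + 1) : ℂ)) := by
    funext n
    have h0 : (dunklFactorial κ n : ℂ) ≠ 0 := by exact_mod_cast (dunklFactorial_pos hκ n).ne'
    have hs : (dunklFactorial κ (n + 1) : ℂ)
        = ((n : ℂ) + 1 + (κ : ℂ) * (1 - (-1) ^ (n + 1))) * (dunklFactorial κ n : ℂ) := by
      rw [dunklFactorial]; push_cast; ring
    have h4 : (dunklFactorial κ (n + 1) : ℂ) ≠ 0 := by
      exact_mod_cast (dunklFactorial_pos hκ (n + 1)).ne'
    rw [hs] at h4 ⊢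
    have h5 : ((n : ℂ) + 1 + (κ : ℂ) * (1 - (-1) ^ (n + 1))) ≠ 0 := left_ne_zero_of_mul h4
    rw [neg_pow z, Nat.add_sub_cancel, div_sub_div_same, ← mul_div_assoc, ← mul_div_assoc,
      ← mul_div_assoc, ← add_div, div_eq_div_iff h0 h4]
    push_cast
    ring
  rw [e] at h2
  have h6 := h2.unique h3
  rw [h6]
  simp

/-- The Dunkl kernel is holomorphic on `ℂ × ℂ`. -/
lemma differentiable_dunklKernel {κ : ℝ} (hκ : 0 ≤ κ) :
    Differentiable ℂ (fun p : ℂ × ℂ => dunklKernel κ p.1 p.2) :=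
  (differentiable_kernelSeries hκ).comp
    (g := kernelSeries κ) (f := fun p : ℂ × ℂ => p.1 * p.2) (by fun_prop)

lemma isDunklEigenfunction_dunklKernel {κ : ℝ} (hκ : 0 ≤ κ) (w : ℂ) :
    IsDunklEigenfunction κ w (fun x : ℝ => dunklKernel κ x w) := by
  have hd : ∀ x : ℝ, HasDerivAt (fun x : ℝ => dunklKernel κ x w)
      (w * deriv (kernelSeries κ) (x * w)) x := by
    intro x
    have h1 : HasDerivAt (fun z : ℂ => z * w) w (x : ℂ) := by
      simpa using (hasDerivAt_id (x : ℂ)).mul_const w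
    have h2 := ((differentiable_kernelSeries hκ) ((x : ℂ) * w)).hasDerivAt.comp (x : ℂ) h1
    have h3 := h2.comp_ofReal
    rw [mul_comm w]
    exact h3
  refine ⟨?_, ?_, ?_⟩
  · intro x _
    have h1 : AnalyticAt ℂ (fun z : ℂ => kernelSeries κ (z * w)) (x : ℂ) :=
      ((differentiable_kernelSeries hκ).comp (f := fun z : ℂ => z * w)
        (by fun_prop)).analyticAt _
    exact (h1.restrictScalars (𝕜 := ℝ)).comp (f := fun x : ℝ => (x : ℂ))
      (Complex.ofRealCLM.analyticAt x)
  · have h := (hasSum_kernelSeries hκ 0).unique (hasSum_single 0 (by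
      intro n hn
      simp [hn]))
    change kernelSeries κ (((0 : ℝ) : ℂ) * w) = 1
    simp [h, dunklFactorial]
  · intro x
    unfold dunklOperator
    split_ifs with hx
    · subst hx
      have h := (hasSum_kernelSeries hκ 0).unique (hasSum_single 0 (by
        intro n hn
        simp [hn]))
      have h1 : dunklKernel κ ((0 : ℝ) : ℂ) w = 1 := by
        change kernelSeries κ (((0 : ℝ) : ℂ) * w) = 1
        simp [h, dunklFactorial]
      have h2 := deriv_kernelSeries_zero hκ
      beta_reduce
      rw [(hd 0).deriv, h1, Complex.ofReal_zero, zero_mul]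
      linear_combination w * h2
    · have hx' : (x : ℂ) ≠ 0 := by exact_mod_cast hx
      have h := kernelSeries_eq hκ ((x : ℂ) * w)
      rw [(hd x).deriv]
      change _ + (κ : ℂ) * ((kernelSeries κ (x * w) - kernelSeries κ (((-x : ℝ) : ℂ) * w)) / x)
        = w * kernelSeries κ (x * w)
      rw [show (((-x : ℝ) : ℂ) * w) = -((x : ℂ) * w) by push_cast; ring]
      generalize kernelSeries κ (-((x : ℂ) * w)) = A at h ⊢
      generalize deriv (kernelSeries κ) ((x : ℂ) * w) = B at h ⊢
      generalize kernelSeries κ ((x : ℂ) * w) = D at h ⊢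
      field_simp
      linear_combination h

lemma eventually_eq_zero_of_eigen {κ : ℝ} (hκ : 0 ≤ κ) {w : ℂ} {h : ℝ → ℂ}
    (ha : AnalyticAt ℝ h 0) (h0 : h 0 = 0)
    (he : ∀ x : ℝ, dunklOperator κ h x = w * h x) : ∀ᶠ x in 𝓝 (0 : ℝ), h x = 0 := by
  by_contra hne
  obtain ⟨n, g, hg, hg0, hgn⟩ := (ha.exists_eventuallyEq_pow_smul_nonzero_iff).mpr hne
  have hn : n ≠ 0 := by
    rintro rfl
    have := hgn.self_of_nhds
    rw [h0] at this
    simp at this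
    exact hg0 this.symm
  -- the quotient of the eigenvalue equation by `x ^ n`
  have hneg : Tendsto (fun x : ℝ => -x) (𝓝 0) (𝓝 0) := by
    simpa using (continuous_neg (G := ℝ)).tendsto 0
  have key : ∀ᶠ x : ℝ in 𝓝[≠] 0, (n : ℂ) * g x + x * deriv g x
      + (κ : ℂ) * (g x - (-1) ^ n * g (-x)) - w * x * g x = 0 := by
    have h1 := hgn.eventually_nhds
    have h2 := hneg.eventually hgn
    have h3 := hg.eventually_analyticAt
    filter_upwards [nhdsWithin_le_nhds h1, nhdsWithin_le_nhds h2, nhdsWithin_le_nhds h3,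
      self_mem_nhdsWithin] with x hx1 hx2 hx3 hx
    have hx : x ≠ 0 := hx
    have hx' : (x : ℂ) ≠ 0 := by exact_mod_cast hx
    have hd : deriv h x = (n : ℂ) * x ^ (n - 1) * g x + x ^ n * deriv g x := by
      have e : h =ᶠ[𝓝 x] fun y : ℝ => (y : ℂ) ^ n * g y := by
        filter_upwards [hx1] with y hy
        rw [hy]
        simp
      rw [e.deriv_eq]
      have d1 : HasDerivAt (fun y : ℝ => (y : ℂ) ^ n) ((n : ℂ) * x ^ (n - 1)) x :=
        (hasDerivAt_pow n (x : ℂ)).comp_ofReal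
      exact (d1.mul hx3.differentiableAt.hasDerivAt).deriv
    have hE := he x
    have v1 : h x = (x : ℂ) ^ n * g x := by rw [hx1.self_of_nhds]; simp
    have v2 : h (-x) = (-1) ^ n * (x : ℂ) ^ n * g (-x) := by
      rw [hx2, ← neg_pow]; simp
    obtain ⟨m, rfl⟩ := Nat.exists_eq_succ_of_ne_zero hn
    rw [dunklOperator, if_neg hx, hd, v1, v2] at hE
    simp only [Nat.succ_eq_add_one, Nat.add_sub_cancel] at hE ⊢
    have hq : ((x : ℂ) ^ (m + 1) * g x - (-1) ^ (m + 1) * (x : ℂ) ^ (m + 1) * g (-x)) / (x : ℂ)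
        = (x : ℂ) ^ m * (g x - (-1) ^ (m + 1) * g (-x)) := by
      rw [div_eq_iff hx']
      ring
    rw [hq] at hE
    have hp : (x : ℂ) ^ m ≠ 0 := pow_ne_zero _ hx'
    apply mul_left_cancel₀ hp
    linear_combination hE
  have lim : Tendsto (fun x : ℝ => (n : ℂ) * g x + x * deriv g x
      + (κ : ℂ) * (g x - (-1) ^ n * g (-x)) - w * x * g x) (𝓝[≠] 0)
      (𝓝 ((n : ℂ) * g 0 + ((0 : ℝ) : ℂ) * deriv g 0
        + (κ : ℂ) * (g 0 - (-1) ^ n * g 0) - w * ((0 : ℝ) : ℂ) * g 0)) := by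
    have c1 : Tendsto g (𝓝 0) (𝓝 (g 0)) := hg.continuousAt
    have c2 : Tendsto (deriv g) (𝓝 0) (𝓝 (deriv g 0)) := hg.deriv.continuousAt
    have c3 : Tendsto (fun x : ℝ => (x : ℂ)) (𝓝 0) (𝓝 ((0 : ℝ) : ℂ)) :=
      Complex.continuous_ofReal.tendsto 0
    have c4 := c1.comp hneg
    refine Tendsto.mono_left ?_ nhdsWithin_le_nhds
    exact (((c1.const_mul _).add (c3.mul c2)).add
      ((c1.sub (c4.const_mul _)).const_mul _)).sub ((c3.const_mul _).mul c1)
  have h0' := tendsto_nhds_unique (lim.congr' key) (tendsto_const_nhds (x := (0 : ℂ)))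
  have hfac : (((n : ℝ) + κ * (1 - (-1) ^ n) : ℝ) : ℂ) * g 0 = 0 := by
    push_cast
    rw [← h0']
    push_cast
    ring
  have hpos : (0 : ℝ) < (n : ℝ) + κ * (1 - (-1) ^ n) := by
    have := mul_nonneg hκ (one_sub_neg_one_pow_nonneg n)
    have : (0 : ℝ) < n := by exact_mod_cast Nat.pos_of_ne_zero hn
    linarith
  rcases mul_eq_zero.mp hfac with h1 | h1
  · exact hpos.ne' (by exact_mod_cast h1)
  · exact hg0 h1

/-- The Dunkl kernel `E(·, w)` is the one and only real-analytic solution of `T f = w f` with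
`f 0 = 1`. -/
lemma isDunklEigenfunction_iff {κ : ℝ} (hκ : 0 ≤ κ) (w : ℂ) (f : ℝ → ℂ) :
    IsDunklEigenfunction κ w f ↔ f = fun x : ℝ => dunklKernel κ x w := by
  constructor
  · rintro ⟨fa, f0, fe⟩
    obtain ⟨ga, g0, ge⟩ := isDunklEigenfunction_dunklKernel hκ w
    set g : ℝ → ℂ := fun x : ℝ => dunklKernel κ x w
    have hev : ∀ᶠ x in 𝓝 (0 : ℝ), (f - g) x = 0 := by
      refine eventually_eq_zero_of_eigen hκ (w := w) ((fa 0 trivial).sub (ga 0 trivial))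
        (by simp [f0, g0]) (fun x => ?_)
      have e1 := fe x
      have e2 := ge x
      have hd := deriv_sub (fa x trivial).differentiableAt (ga x trivial).differentiableAt
      unfold dunklOperator at e1 e2 ⊢
      split_ifs at e1 e2 ⊢ with hx
      · subst hx
        rw [hd, Pi.sub_apply]
        linear_combination e1 - e2
      · rw [hd, Pi.sub_apply, Pi.sub_apply]
        linear_combination e1 - e2
    refine fa.eq_of_eventuallyEq ga (z₀ := 0) ?_
    filter_upwards [hev] with x hx
    exact sub_eq_zero.mp hx
  · rintro rfl
    exact isDunklEigenfunction_dunklKernel hκ w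

end KernelFacts

/-- The weighted measure `|x| ^ (2κ) dx`. -/
def dunklMeasure (κ : ℝ) : Measure ℝ :=
  volume.withDensity (fun x => ENNReal.ofReal (|x| ^ (2 * κ)))

/-- The Mehta-type constant. -/
def mehtaConst (κ : ℝ) : ℝ := (∫ x : ℝ, Real.exp (-x ^ 2 / 2) ∂dunklMeasure κ)⁻¹

/-- The Dunkl transform of an integrable function. -/
def dunklTransform (κ : ℝ) (f : ℝ → ℂ) (x : ℝ) : ℂ :=
  (mehtaConst κ : ℂ) * ∫ y : ℝ, dunklKernel κ (-Complex.I * x) y * f y ∂dunklMeasure κ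

/-- `F` is the Dunkl transform of `f` in the sense of `L²`: the pair `(f, F)` is an `L² × L²` limit
of pairs `(u, dunklTransform κ u)` with `u ∈ L¹ ∩ L²`. By Plancherel's theorem this is the graph of
the unique continuous extension of the Dunkl transform from `L¹ ∩ L²` to `L²`. -/
def IsDunklTransformL2 (κ : ℝ) (f F : ℝ → ℂ) : Prop :=
  MemLp f 2 (dunklMeasure κ) ∧ MemLp F 2 (dunklMeasure κ) ∧
    ∃ u : ℕ → ℝ → ℂ,
      (∀ k, MemLp (u k) 1 (dunklMeasure κ) ∧ MemLp (u k) 2 (dunklMeasure κ)) ∧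
      Tendsto (fun k => eLpNorm (u k - f) 2 (dunklMeasure κ)) atTop (𝓝 0) ∧
      Tendsto (fun k => eLpNorm (dunklTransform κ (u k) - F) 2 (dunklMeasure κ)) atTop (𝓝 0)

/-- `g ∈ L²` represents the Dunkl translate `τ_x f` of `f ∈ L²`: the `L²` Dunkl transforms satisfy
`𝓕 g (y) = E(i x, y) 𝓕 f (y)` for almost every `y`. -/
def IsDunklTranslate (κ : ℝ) (x : ℝ) (f g : ℝ → ℂ) : Prop :=
  ∃ F G : ℝ → ℂ, IsDunklTransformL2 κ f F ∧ IsDunklTransformL2 κ g G ∧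
    G =ᵐ[dunklMeasure κ] fun y : ℝ => dunklKernel κ (Complex.I * x) y * F y

open Classical in
/-- The Dunkl translation `τ_x f`, a representative of the almost everywhere unique element of `L²`
given by `IsDunklTranslate`. -/
def dunklTranslation (κ : ℝ) (x : ℝ) (f : ℝ → ℂ) : ℝ → ℂ :=
  if h : ∃ g, IsDunklTranslate κ x f g then h.choose else 0

/-- The Dunkl maximal operator
`M f (x) = sup_{r > 0} μ(B_r)⁻¹ |∫ f(y) τ_x(χ_{B_r})(-y) dμ(y)|`, with values in `[0, ∞]`. -/
def dunklMaximal (κ : ℝ) (f : ℝ → ℂ) (x : ℝ) : ℝ≥0∞ :=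
  ⨆ (ρ : ℝ) (_ : 0 < ρ), (dunklMeasure κ (Metric.ball 0 ρ))⁻¹ *
    ‖∫ y : ℝ, f y * dunklTranslation κ x ((Metric.ball (0 : ℝ) ρ).indicator 1) (-y)
      ∂dunklMeasure κ‖ₑ

/-- The `ℓ^r` norm of a sequence in `[0, ∞]` indexed by `n ≥ 1`. -/
def lrNorm (r : ℝ) (a : ℕ+ → ℝ≥0∞) : ℝ≥0∞ := (∑' n, a n ^ r) ^ (1 / r)

/-- `x ↦ ‖f(x)‖_{ℓ^r}`. -/
def seqNorm (r : ℝ) (f : ℕ+ → ℝ → ℂ) (x : ℝ) : ℝ≥0∞ := lrNorm r (fun n => ‖f n x‖ₑ)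

/-- `x ↦ ‖(M f_n (x))_n‖_{ℓ^r}` for the Dunkl-type Fefferman–Stein operator. -/
def seqMaximalNorm (κ r : ℝ) (f : ℕ+ → ℝ → ℂ) (x : ℝ) : ℝ≥0∞ :=
  lrNorm r (fun n => dunklMaximal κ (f n) x)

/-- The indicator functions `f_n` of `[2 ^ (n - 1), 2 ^ n)`, `n ≥ 1`. -/
def dyadicSeq (n : ℕ+) : ℝ → ℂ :=
  (Ico ((2 : ℝ) ^ ((n : ℕ) - 1)) ((2 : ℝ) ^ (n : ℕ))).indicator 1

end Dunkl

end

/-! The core is a support property of the Dunkl translation: `τ_x χ_{B_ρ} = 1` almost everywhere on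
`|y| < ρ - |x|` (`dunklTranslation_ballIndicator_eq_one`). Granted this, take `|x| ≤ 2 ^ n` and `ρ =
2 ^ (n + 1)`. The block `[2 ^ (n - 1), 2 ^ n)` lies in `|y| < ρ - |x|`, so the average defining the
maximal function at radius `ρ` is the ratio of the measures of the block and the ball. By
homogeneity of the weight this ratio does not depend on `n`. At a fixed `x` all but finitely many
terms of the maximal sequence therefore exceed one positive constant, and its `ℓ^r` norm is
infinite, while disjointness of the blocks keeps the `ℓ^r` norm of the original sequence at most
`1`.

The support property is finite speed of propagation. As a function of `(t, y)`, a regularized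
translate `u = τ_t f (y)` of an even function solves `T_t u = T_y u`. Writing `u = P - Q`, with `P`
even and `Q` odd in each variable, gives a first-order system with unit speed and a damping term `2κ
Q / t`. The constant `(P, Q) = (1, 0)` is a solution, so the energy of `(P - 1, Q)`, weighted by a
cutoff supported in the backward cone `y + t ≤ R`, is nonincreasing for `t ≥ 0`
(`waveEnergy_le_waveEnergy_zero`). If the initial value is close to `1` in `L²` of the ball of
radius `ρ`, the translate by `x` is close to `1` in `L²` of every ball of radius less than `ρ -
|x|`. Removing the regularization gives equality.

Since the translation is defined through the `L²` transform, Plancherel and inversion come first.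
They are obtained from the functions `y ^ j exp (-s y² / 2)`, `j = 0, 1`: their transforms are
explicit, their Gram matrix is preserved, and their span is dense by Weierstrass approximation. This
yields an isometry `dunklL2` whose square is the reflection, and `isDunklTransformL2_iff` identifies
it with the transform of the statement. -/

noncomputable section

namespace Dunkl

/-! ### The Dunkl kernel on the imaginary axis -/

/-- The even part of the Dunkl kernel on the imaginary axis. -/
def dunklCos (κ : ℝ) (z : ℝ) : ℝ := (kernelSeries κ (Complex.I * z)).re

/-- The odd part of the Dunkl kernel on the imaginary axis. -/
def dunklSin (κ : ℝ) (z : ℝ) : ℝ := (kernelSeries κ (Complex.I * z)).im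

lemma kernelSeries_conj (κ : ℝ) (z : ℂ) :
    kernelSeries κ ((starRingEnd ℂ) z) = (starRingEnd ℂ) (kernelSeries κ z) := by
  unfold kernelSeries
  rw [Complex.conj_tsum]
  simp

lemma kernelSeries_I_mul (κ : ℝ) (z : ℝ) :
    kernelSeries κ (Complex.I * z) = dunklCos κ z + dunklSin κ z * Complex.I :=
  (Complex.re_add_im _).symm

lemma kernelSeries_neg_I_mul (κ : ℝ) (z : ℝ) :
    kernelSeries κ (-(Complex.I * z)) = dunklCos κ z - dunklSin κ z * Complex.I := by
  have h : -(Complex.I * (z : ℂ)) = (starRingEnd ℂ) (Complex.I * z) := by simp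
  rw [h, kernelSeries_conj, kernelSeries_I_mul]
  simp [sub_eq_add_neg]

lemma dunklCos_neg (κ z : ℝ) : dunklCos κ (-z) = dunklCos κ z := by
  have h := kernelSeries_neg_I_mul κ z
  unfold dunklCos at *
  rw [show Complex.I * ((-z : ℝ) : ℂ) = -(Complex.I * z) by push_cast; ring, h]
  simp

lemma dunklSin_neg (κ z : ℝ) : dunklSin κ (-z) = -dunklSin κ z := by
  have h := kernelSeries_neg_I_mul κ z
  unfold dunklSin at *
  rw [show Complex.I * ((-z : ℝ) : ℂ) = -(Complex.I * z) by push_cast; ring, h]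
  simp

lemma kernelSeries_zero {κ : ℝ} (hκ : 0 ≤ κ) : kernelSeries κ 0 = 1 := by
  have h := (hasSum_kernelSeries hκ 0).unique (hasSum_single 0 (by
    intro n hn
    simp [hn]))
  simp [h, dunklFactorial]

lemma dunklCos_zero {κ : ℝ} (hκ : 0 ≤ κ) : dunklCos κ 0 = 1 := by
  simp [dunklCos, kernelSeries_zero hκ]

lemma dunklSin_zero {κ : ℝ} (hκ : 0 ≤ κ) : dunklSin κ 0 = 0 := by
  simp [dunklSin, kernelSeries_zero hκ]

lemma hasDerivAt_kernelSeries_I_mul {κ : ℝ} (hκ : 0 ≤ κ) (z : ℝ) :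
    HasDerivAt (fun z : ℝ => kernelSeries κ (Complex.I * z))
      (Complex.I * deriv (kernelSeries κ) (Complex.I * z)) z := by
  have h1 : HasDerivAt (fun z : ℂ => Complex.I * z) Complex.I (z : ℂ) := by
    simpa using (hasDerivAt_id (z : ℂ)).const_mul Complex.I
  have h2 := ((differentiable_kernelSeries hκ) (Complex.I * (z : ℂ))).hasDerivAt.comp (z : ℂ) h1
  rw [mul_comm]
  exact h2.comp_ofReal

lemma hasDerivAt_dunklCos_aux {κ : ℝ} (hκ : 0 ≤ κ) (z : ℝ) :
    HasDerivAt (dunklCos κ) (Complex.I * deriv (kernelSeries κ) (Complex.I * z)).re z :=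
  Complex.reCLM.hasFDerivAt.comp_hasDerivAt z (hasDerivAt_kernelSeries_I_mul hκ z)

lemma hasDerivAt_dunklSin_aux {κ : ℝ} (hκ : 0 ≤ κ) (z : ℝ) :
    HasDerivAt (dunklSin κ) (Complex.I * deriv (kernelSeries κ) (Complex.I * z)).im z :=
  Complex.imCLM.hasFDerivAt.comp_hasDerivAt z (hasDerivAt_kernelSeries_I_mul hκ z)

lemma continuous_dunklCos {κ : ℝ} (hκ : 0 ≤ κ) : Continuous (dunklCos κ) :=
  continuous_iff_continuousAt.2 fun z => (hasDerivAt_dunklCos_aux hκ z).continuousAt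

lemma continuous_dunklSin {κ : ℝ} (hκ : 0 ≤ κ) : Continuous (dunklSin κ) :=
  continuous_iff_continuousAt.2 fun z => (hasDerivAt_dunklSin_aux hκ z).continuousAt

/-- The eigenvalue equation at `I * z`. With `A = dunklCos`, `B = dunklSin`, its real and imaginary
parts are the system `A' = -B`, `B' = A - 2κ B / z`, on which all later estimates rest. -/
lemma kernelSeries_I_mul_eq {κ : ℝ} (hκ : 0 ≤ κ) (z : ℝ) :
    z * (Complex.I * deriv (kernelSeries κ) (Complex.I * z)) + 2 * κ * dunklSin κ z * Complex.I =
      Complex.I * z * (dunklCos κ z + dunklSin κ z * Complex.I) := by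
  have h := kernelSeries_eq hκ (Complex.I * z)
  rw [kernelSeries_neg_I_mul, kernelSeries_I_mul] at h
  linear_combination h

lemma hasDerivAt_dunklCos {κ : ℝ} (hκ : 0 ≤ κ) (z : ℝ) :
    HasDerivAt (dunklCos κ) (-dunklSin κ z) z := by
  have h := hasDerivAt_dunklCos_aux hκ z
  convert h using 1
  -- The eigenvalue equation carries a factor `z`, so it says nothing at `0`; there evenness forces
  -- the derivative to vanish.
  rcases eq_or_ne z 0 with rfl | hz
  · have h2 : HasDerivAt (dunklCos κ) (-(Complex.I * deriv (kernelSeries κ)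
        (Complex.I * (0 : ℝ))).re) 0 := by
      have h3 : HasDerivAt (fun z => dunklCos κ (-z)) _ (0 : ℝ) :=
        HasDerivAt.comp (0 : ℝ) (h₂ := dunklCos κ) (by simpa using h) (hasDerivAt_neg (0 : ℝ))
      simpa [dunklCos_neg] using h3
    have := h.unique h2
    rw [dunklSin_zero hκ]
    linarith
  · have e := congrArg Complex.re (kernelSeries_I_mul_eq hκ z)
    generalize Complex.I * deriv (kernelSeries κ) (Complex.I * z) = w at e ⊢
    simp at e
    apply mul_left_cancel₀ hz
    linarith

lemma hasDerivAt_dunklSin {κ : ℝ} (hκ : 0 ≤ κ) {z : ℝ} (hz : z ≠ 0) :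
    HasDerivAt (dunklSin κ) (dunklCos κ z - 2 * κ * dunklSin κ z / z) z := by
  have h := hasDerivAt_dunklSin_aux hκ z
  convert h using 1
  have e := congrArg Complex.im (kernelSeries_I_mul_eq hκ z)
  generalize Complex.I * deriv (kernelSeries κ) (Complex.I * z) = w at e ⊢
  simp at e
  field_simp
  linarith

/-- By the system, `A² + B²` has derivative `-4κ B² / z ≤ 0` for `z > 0`, and it starts from `1`.
This bounds the kernel on the imaginary axis without an integral representation. -/
lemma dunklCos_sq_add_dunklSin_sq_le_one {κ : ℝ} (hκ : 0 ≤ κ) (z : ℝ) :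
    dunklCos κ z ^ 2 + dunklSin κ z ^ 2 ≤ 1 := by
  wlog hz : 0 ≤ z generalizing z
  · simpa [dunklCos_neg, dunklSin_neg] using this (-z) (by linarith)
  have hanti : AntitoneOn (fun z => dunklCos κ z ^ 2 + dunklSin κ z ^ 2) (Ici 0) := by
    apply antitoneOn_of_hasDerivWithinAt_nonpos (convex_Ici 0)
      (f' := fun z => -(4 * κ * dunklSin κ z ^ 2 / z))
    · exact (((continuous_dunklCos hκ).pow 2).add ((continuous_dunklSin hκ).pow 2)).continuousOn
    · intro x hx
      rw [interior_Ici] at hx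
      have hx0 : x ≠ 0 := (ne_of_gt hx)
      refine HasDerivAt.hasDerivWithinAt ?_
      have h := ((hasDerivAt_dunklCos hκ x).fun_pow 2).fun_add
        ((hasDerivAt_dunklSin hκ hx0).fun_pow 2)
      convert h using 1
      push_cast
      field_simp
      ring
    · intro x hx
      rw [interior_Ici] at hx
      have hx0 : 0 < x := hx
      have : 0 ≤ 4 * κ * dunklSin κ x ^ 2 / x := by positivity
      linarith
  have := hanti (mem_Ici.2 le_rfl) hz hz
  simpa [dunklCos_zero hκ, dunklSin_zero hκ] using this

lemma abs_dunklCos_le_one {κ : ℝ} (hκ : 0 ≤ κ) (z : ℝ) : |dunklCos κ z| ≤ 1 := by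
  have := dunklCos_sq_add_dunklSin_sq_le_one hκ z
  exact abs_le_one_iff_mul_self_le_one.2 (by nlinarith [sq_nonneg (dunklSin κ z)])

lemma abs_dunklSin_le_one {κ : ℝ} (hκ : 0 ≤ κ) (z : ℝ) : |dunklSin κ z| ≤ 1 := by
  have := dunklCos_sq_add_dunklSin_sq_le_one hκ z
  exact abs_le_one_iff_mul_self_le_one.2 (by nlinarith [sq_nonneg (dunklCos κ z)])

lemma dunklKernel_I_mul (κ x y : ℝ) :
    dunklKernel κ (Complex.I * x) y = dunklCos κ (x * y) + dunklSin κ (x * y) * Complex.I := by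
  rw [← kernelSeries_I_mul]
  change kernelSeries κ (Complex.I * x * y) = _
  push_cast
  ring_nf

lemma dunklKernel_neg_I_mul (κ x y : ℝ) :
    dunklKernel κ (-Complex.I * x) y = dunklCos κ (x * y) - dunklSin κ (x * y) * Complex.I := by
  rw [← kernelSeries_neg_I_mul]
  change kernelSeries κ (-Complex.I * x * y) = _
  push_cast
  ring_nf

lemma norm_dunklKernel_I_mul_le {κ : ℝ} (hκ : 0 ≤ κ) (x y : ℝ) :
    ‖dunklKernel κ (Complex.I * x) y‖ ≤ 1 := by
  rw [dunklKernel_I_mul, Complex.norm_add_mul_I]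
  exact Real.sqrt_le_one.2 (dunklCos_sq_add_dunklSin_sq_le_one hκ _)

lemma dunklKernel_neg_I_mul_eq (κ x y : ℝ) :
    dunklKernel κ (-Complex.I * x) y = dunklKernel κ (Complex.I * (-x : ℝ)) y := by
  push_cast; ring_nf

lemma norm_dunklKernel_neg_I_mul_le {κ : ℝ} (hκ : 0 ≤ κ) (x y : ℝ) :
    ‖dunklKernel κ (-Complex.I * x) y‖ ≤ 1 := by
  rw [dunklKernel_neg_I_mul_eq]
  exact norm_dunklKernel_I_mul_le hκ _ _

lemma continuous_dunklKernel_neg_I_mul {κ : ℝ} (hκ : 0 ≤ κ) :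
    Continuous (fun p : ℝ × ℝ => dunklKernel κ (-Complex.I * p.1) p.2) :=
  (differentiable_dunklKernel hκ).continuous.comp
    (f := fun p : ℝ × ℝ => ((-Complex.I * p.1 : ℂ), (p.2 : ℂ))) (by fun_prop)

lemma continuous_dunklKernel_I_mul {κ : ℝ} (hκ : 0 ≤ κ) :
    Continuous (fun p : ℝ × ℝ => dunklKernel κ (Complex.I * p.1) p.2) :=
  (differentiable_dunklKernel hκ).continuous.comp
    (f := fun p : ℝ × ℝ => ((Complex.I * p.1 : ℂ), (p.2 : ℂ))) (by fun_prop)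

/-! ### The weighted measure -/

lemma measurable_weight (κ : ℝ) : Measurable fun x : ℝ => |x| ^ (2 * κ) := by fun_prop

lemma continuous_weight {κ : ℝ} (hκ : 0 ≤ κ) : Continuous fun x : ℝ => |x| ^ (2 * κ) :=
  continuous_abs.rpow_const fun _ => Or.inr (by positivity)

lemma weight_nonneg (κ x : ℝ) : 0 ≤ |x| ^ (2 * κ) := by positivity

section Integral

variable {E : Type*} [NormedAddCommGroup E] [NormedSpace ℝ E]

lemma integral_dunklMeasure (κ : ℝ) (f : ℝ → E) :
    ∫ x, f x ∂dunklMeasure κ = ∫ x, (|x| ^ (2 * κ)) • f x := by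
  unfold dunklMeasure
  rw [integral_withDensity_eq_integral_toReal_smul (measurable_weight κ).ennreal_ofReal
    (by simp)]
  simp [ENNReal.toReal_ofReal (weight_nonneg κ _)]

lemma integrable_dunklMeasure_iff (κ : ℝ) (f : ℝ → E) :
    Integrable f (dunklMeasure κ) ↔ Integrable fun x => (|x| ^ (2 * κ)) • f x := by
  unfold dunklMeasure
  rw [integrable_withDensity_iff_integrable_smul' (measurable_weight κ).ennreal_ofReal
    (by simp)]
  simp [ENNReal.toReal_ofReal (weight_nonneg κ _)]

end Integral

lemma dunklMeasure_absolutelyContinuous (κ : ℝ) : dunklMeasure κ ≪ volume :=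
  withDensity_absolutelyContinuous _ _

instance (κ : ℝ) : NullSingletonClass (dunklMeasure κ) :=
  ⟨fun x => dunklMeasure_absolutelyContinuous κ (by simp)⟩

instance (κ : ℝ) : SigmaFinite (dunklMeasure κ) := by
  unfold dunklMeasure
  exact SigmaFinite.withDensity_ofReal _

lemma isLocallyFiniteMeasure_dunklMeasure {κ : ℝ} (hκ : 0 ≤ κ) :
    IsLocallyFiniteMeasure (dunklMeasure κ) :=
  IsLocallyFiniteMeasure.withDensity_ofReal (continuous_weight hκ)

lemma measurePreserving_neg_dunklMeasure (κ : ℝ) :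
    MeasurePreserving (fun x : ℝ => -x) (dunklMeasure κ) (dunklMeasure κ) := by
  refine ⟨measurable_neg, ?_⟩
  ext s hs
  rw [Measure.map_apply measurable_neg hs]
  unfold dunklMeasure
  rw [withDensity_apply _ hs, withDensity_apply _ (measurable_neg hs)]
  have := (Measure.measurePreserving_neg (volume : Measure ℝ)).setLIntegral_comp_preimage hs
    (measurable_weight κ).ennreal_ofReal
  simpa using this

lemma dunklMeasure_ne_zero {κ : ℝ} : dunklMeasure κ ≠ 0 := by
  intro h
  have h1 : ∀ᵐ x : ℝ, ENNReal.ofReal (|x| ^ (2 * κ)) = 0 :=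
    (withDensity_eq_zero_iff (measurable_weight κ).ennreal_ofReal.aemeasurable).1 h
  have h2 : ∀ᵐ x : ℝ, x ≠ 0 := by simp [ae_iff]
  obtain ⟨x, h3, h4⟩ := (h1.and h2).exists
  have : 0 < |x| ^ (2 * κ) := by positivity
  simp [this.not_ge] at h3

/-! ### Gaussians and their moments -/

/-- The Gaussian `exp (-s y² / 2)`. -/
def gauss (s y : ℝ) : ℝ := Real.exp (-(s * y ^ 2 / 2))

lemma gauss_pos (s y : ℝ) : 0 < gauss s y := Real.exp_pos _

lemma continuous_gauss (s : ℝ) : Continuous (gauss s) := by unfold gauss; fun_prop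

lemma gauss_neg (s y : ℝ) : gauss s (-y) = gauss s y := by simp [gauss]

lemma gauss_zero (s : ℝ) : gauss s 0 = 1 := by simp [gauss]

lemma gauss_mul_gauss (s t y : ℝ) : gauss s y * gauss t y = gauss (s + t) y := by
  unfold gauss
  rw [← Real.exp_add]
  ring_nf

lemma gauss_le_one {s : ℝ} (hs : 0 ≤ s) (y : ℝ) : gauss s y ≤ 1 := by
  unfold gauss
  rw [Real.exp_le_one_iff]
  have : 0 ≤ s * y ^ 2 / 2 := by positivity
  linarith

lemma hasDerivAt_gauss (s y : ℝ) : HasDerivAt (gauss s) (-(s * y) * gauss s y) y := by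
  unfold gauss
  have h : HasDerivAt (fun y : ℝ => -(s * y ^ 2 / 2)) (-(s * y)) y := by
    have := (((hasDerivAt_pow 2 y).const_mul s).div_const 2).fun_neg
    refine this.congr_deriv ?_
    push_cast
    ring
  simpa only [mul_comm] using h.exp

lemma integrable_comp_abs_of_integrableOn_Ioi {f : ℝ → ℝ} (hf : IntegrableOn f (Ioi 0)) :
    Integrable (fun x => f |x|) := by
  have h1 : IntegrableOn (fun x => f |x|) (Ioi 0) :=
    hf.congr_fun (fun x hx => by rw [abs_of_pos hx]) measurableSet_Ioi
  have h2 : IntegrableOn (fun x => f |x|) (Iic 0) := by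
    rw [← Measure.map_neg_eq_self (volume : Measure ℝ)]
    let m : MeasurableEmbedding fun x : ℝ => -x := (Homeomorph.neg ℝ).measurableEmbedding
    rw [m.integrableOn_map_iff]
    simp_rw [Function.comp_def, abs_neg, neg_preimage, neg_Iic, neg_zero]
    exact Iff.mpr integrableOn_Ici_iff_integrableOn_Ioi h1
  rw [← integrableOn_univ, ← Iic_union_Ioi (a := (0 : ℝ))]
  exact h2.union h1

lemma integrable_pow_mul_gauss {κ : ℝ} (hκ : 0 ≤ κ) (n : ℕ) {s : ℝ} (hs : 0 < s) :
    Integrable (fun y => y ^ n * gauss s y) (dunklMeasure κ) := by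
  rw [integrable_dunklMeasure_iff]
  have h := integrableOn_rpow_mul_exp_neg_mul_sq (b := s / 2) (by positivity)
    (s := 2 * κ + n) (by have : (0 : ℝ) ≤ n := n.cast_nonneg
                         linarith)
  refine (integrable_comp_abs_of_integrableOn_Ioi h).mono ?_ (Eventually.of_forall fun y => ?_)
  · exact ((continuous_weight hκ).smul
      ((continuous_pow n).mul (continuous_gauss s))).aestronglyMeasurable
  · have h0 : 0 ≤ |y| := abs_nonneg y
    rw [Real.rpow_add_of_nonneg h0 (by positivity) (by positivity), Real.rpow_natCast,
      show Real.exp (-(s / 2) * |y| ^ 2) = gauss s y by rw [sq_abs, gauss]; ring_nf, smul_eq_mul]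
    simp only [norm_mul, norm_pow, Real.norm_eq_abs, abs_abs, mul_assoc]
    exact le_rfl

lemma integrable_mul_pow_mul_gauss {κ : ℝ} (hκ : 0 ≤ κ) (n : ℕ) {s : ℝ} (hs : 0 < s) {b : ℝ → ℝ}
    (hb : Continuous b) {C : ℝ} (hC : ∀ y, |b y| ≤ C) :
    Integrable (fun y => b y * (y ^ n * gauss s y)) (dunklMeasure κ) :=
  (integrable_pow_mul_gauss hκ n hs).bdd_mul hb.aestronglyMeasurable
    (Eventually.of_forall fun y => hC y)

lemma integrable_gauss {κ : ℝ} (hκ : 0 ≤ κ) {s : ℝ} (hs : 0 < s) :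
    Integrable (gauss s) (dunklMeasure κ) := by
  simpa using integrable_pow_mul_gauss hκ 0 hs

/-- Substitute `√s * y`: the weight, the monomial and `dy` contribute `2κ`, `2j` and `1` to the
power of `√s`. -/
lemma integral_pow_mul_gauss {κ : ℝ} (j : ℕ) {s : ℝ} (hs : 0 < s) :
    ∫ y, y ^ (2 * j) * gauss s y ∂dunklMeasure κ =
      s ^ (-(κ + j + 1 / 2)) * ∫ y, y ^ (2 * j) * gauss 1 y ∂dunklMeasure κ := by
  rw [integral_dunklMeasure, integral_dunklMeasure]
  have h := Measure.integral_comp_mul_left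
    (fun y : ℝ => |y| ^ (2 * κ) • (y ^ (2 * j) * gauss 1 y)) (√s)
  have hsq : 0 < √s := Real.sqrt_pos.2 hs
  have e : ∀ y : ℝ, |√s * y| ^ (2 * κ) • ((√s * y) ^ (2 * j) * gauss 1 (√s * y)) =
      s ^ (κ + j) * (|y| ^ (2 * κ) • (y ^ (2 * j) * gauss s y)) := by
    intro y
    rw [abs_mul, Real.mul_rpow (abs_nonneg _) (abs_nonneg _), abs_of_pos hsq, mul_pow,
      Real.rpow_mul hsq.le, Real.rpow_two, Real.sq_sqrt hs.le, pow_mul (√s), Real.sq_sqrt hs.le,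
      Real.rpow_add hs, Real.rpow_natCast]
    have : gauss 1 (√s * y) = gauss s y := by
      unfold gauss; rw [mul_pow, Real.sq_sqrt hs.le]; ring_nf
    rw [this]
    simp only [smul_eq_mul]
    ring
  simp_rw [e] at h
  rw [integral_const_mul, abs_of_pos (inv_pos.2 hsq)] at h
  rw [show -(κ + j + 1 / 2) = -(κ + j) + -(1 / 2) by ring, Real.rpow_add hs,
    Real.rpow_neg hs.le (κ + j), Real.rpow_neg hs.le (1 / 2), ← Real.sqrt_eq_rpow]
  have h3 : 0 < s ^ (κ + j) := Real.rpow_pos_of_pos hs _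
  rw [mul_assoc, ← smul_eq_mul (√s)⁻¹, ← h]
  field_simp

lemma integral_gauss {κ : ℝ} {s : ℝ} (hs : 0 < s) :
    ∫ y, gauss s y ∂dunklMeasure κ = s ^ (-(κ + 1 / 2)) * ∫ y, gauss 1 y ∂dunklMeasure κ := by
  simpa using integral_pow_mul_gauss (κ := κ) 0 hs

lemma integral_gauss_one_pos {κ : ℝ} (hκ : 0 ≤ κ) : 0 < ∫ y, gauss 1 y ∂dunklMeasure κ := by
  rw [integral_pos_iff_support_of_nonneg (fun y => (gauss_pos 1 y).le) (integrable_gauss hκ one_pos)]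
  rw [show Function.support (gauss 1) = univ from
    eq_univ_of_forall fun y => (gauss_pos 1 y).ne']
  exact Measure.measure_univ_pos.2 dunklMeasure_ne_zero

lemma mehtaConst_eq (κ : ℝ) : mehtaConst κ = (∫ y, gauss 1 y ∂dunklMeasure κ)⁻¹ := by
  unfold mehtaConst gauss
  congr! 4 with y
  ring

lemma mehtaConst_pos {κ : ℝ} (hκ : 0 ≤ κ) : 0 < mehtaConst κ := by
  rw [mehtaConst_eq]
  exact inv_pos.2 (integral_gauss_one_pos hκ)

/-! ### Dunkl transforms of Gaussian monomials -/

/-- Integration by parts against a Gaussian. -/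
lemma mul_integral_mul_dunklSin_mul_gauss {κ : ℝ} (hκ : 0 ≤ κ) {s : ℝ} (hs : 0 < s) (x : ℝ) :
    s * ∫ y, dunklSin κ (x * y) * (y * gauss s y) ∂dunklMeasure κ =
      x * ∫ y, dunklCos κ (x * y) * gauss s y ∂dunklMeasure κ := by
  have hA : Continuous fun y => dunklCos κ (x * y) := (continuous_dunklCos hκ).comp (by fun_prop)
  have hB : Continuous fun y => dunklSin κ (x * y) := (continuous_dunklSin hκ).comp (by fun_prop)
  have i1 : Integrable (fun y => dunklCos κ (x * y) * gauss s y) (dunklMeasure κ) := by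
    simpa using integrable_mul_pow_mul_gauss hκ 0 hs hA (fun y => abs_dunklCos_le_one hκ _)
  have i2 : Integrable (fun y => dunklSin κ (x * y) * (y * gauss s y)) (dunklMeasure κ) := by
    simpa using integrable_mul_pow_mul_gauss hκ 1 hs hB (fun y => abs_dunklSin_le_one hκ _)
  have i3 : Integrable (fun y => dunklSin κ (x * y) * gauss s y) (dunklMeasure κ) := by
    simpa using integrable_mul_pow_mul_gauss hκ 0 hs hB (fun y => abs_dunklSin_le_one hκ _)
  -- On the half-line `y ^ (2κ) * g y` is the derivative of `y ^ (2κ) * B (x y) * gauss s y`: the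
  -- term `-2κ B / z` in `B'` cancels the derivative of the weight. Since `g` is even, its integral
  -- over the half-line suffices.
  set g : ℝ → ℝ := fun y => x * (dunklCos κ (x * y) * gauss s y) -
    s * (dunklSin κ (x * y) * (y * gauss s y)) with hg
  have i4 : Integrable g (dunklMeasure κ) := (i1.const_mul x).sub (i2.const_mul s)
  have h0 : ∫ y, g y ∂dunklMeasure κ = 0 := by
    rw [integral_dunklMeasure]
    have e : ∀ y : ℝ, |y| ^ (2 * κ) • g y =
        (fun y : ℝ => y ^ (2 * κ) * g y) |y| := by
      intro y
      rcases abs_choice y with h | h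
      · simp [h]
      · simp only [h, smul_eq_mul, hg, mul_neg, dunklCos_neg, dunklSin_neg, gauss_neg]
        ring
    rw [integral_congr_ae (Eventually.of_forall e), integral_comp_abs (f := fun y : ℝ => y ^ (2 * κ) * g y)]
    have i5 : IntegrableOn (fun y : ℝ => y ^ (2 * κ) * g y) (Ioi 0) :=
      ((integrable_dunklMeasure_iff _ _).1 i4).integrableOn.congr_fun
        (fun y hy => by simp [abs_of_pos (mem_Ioi.1 hy)]) measurableSet_Ioi
    have i6 : IntegrableOn (fun y : ℝ => y ^ (2 * κ) * (dunklSin κ (x * y) * gauss s y)) (Ioi 0) :=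
      ((integrable_dunklMeasure_iff _ _).1 i3).integrableOn.congr_fun
        (fun y hy => by simp [abs_of_pos (mem_Ioi.1 hy)]) measurableSet_Ioi
    have hd : ∀ y ∈ Ioi (0 : ℝ), HasDerivAt
        (fun y : ℝ => y ^ (2 * κ) * (dunklSin κ (x * y) * gauss s y)) (y ^ (2 * κ) * g y) y := by
      intro y hy
      have hy0 : 0 < y := hy
      have hw := Real.hasDerivAt_rpow_const (x := y) (p := 2 * κ) (Or.inl hy0.ne')
      rcases eq_or_ne x 0 with rfl | hx
      · simpa [hg, dunklSin_zero hκ] using hasDerivAt_const y (0 : ℝ)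
      have hs' := (hasDerivAt_dunklSin hκ (z := x * y) (by positivity)).comp y
        ((hasDerivAt_id y).const_mul x)
      have h := hw.mul (hs'.mul (hasDerivAt_gauss s y))
      refine h.congr_deriv ?_
      simp only [hg, Function.comp, Pi.mul_apply]
      rw [Real.rpow_sub_one hy0.ne']
      field_simp
      ring
    have hc : Continuous (fun y : ℝ => y ^ (2 * κ) * (dunklSin κ (x * y) * gauss s y)) :=
      (continuous_id.rpow_const fun _ => Or.inr (by positivity)).mul (hB.mul (continuous_gauss s))
    have ht := tendsto_zero_of_hasDerivAt_of_integrableOn_Ioi hd i5 i6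
    rw [integral_Ioi_of_hasDerivAt_of_tendsto hc.continuousWithinAt hd i5 ht]
    simp [dunklSin_zero hκ]
  rw [hg, integral_sub (i1.const_mul x) (i2.const_mul s), integral_const_mul,
    integral_const_mul] at h0
  linarith

/-- Differentiating under the integral and integrating by parts, the left side `φ` satisfies `φ' =
-(x / s) φ`. Hence `φ * gauss (-s⁻¹)` is constant, equal to its value at `0`. -/
lemma integral_dunklCos_mul_gauss {κ : ℝ} (hκ : 0 ≤ κ) {s : ℝ} (hs : 0 < s) (x : ℝ) :
    ∫ y, dunklCos κ (x * y) * gauss s y ∂dunklMeasure κ =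
      (∫ y, gauss s y ∂dunklMeasure κ) * gauss s⁻¹ x := by
  have hd : ∀ x, HasDerivAt (fun x => ∫ y, dunklCos κ (x * y) * gauss s y ∂dunklMeasure κ)
      (-(x / s) * ∫ y, dunklCos κ (x * y) * gauss s y ∂dunklMeasure κ) x := by
    intro x
    have h := hasDerivAt_integral_of_dominated_loc_of_deriv_le (μ := dunklMeasure κ)
      (F := fun x y => dunklCos κ (x * y) * gauss s y)
      (F' := fun x y => -(dunklSin κ (x * y) * (y * gauss s y)))
      (bound := fun y => ‖y * gauss s y‖) (x₀ := x) (s := univ) univ_mem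
      (Eventually.of_forall fun x => ?_) ?_ ?_ ?_ ?_ ?_
    · refine h.2.congr_deriv ?_
      rw [integral_neg, neg_mul, div_mul_eq_mul_div, ← mul_integral_mul_dunklSin_mul_gauss hκ hs]
      field_simp
    · exact (((continuous_dunklCos hκ).comp (by fun_prop)).mul
        (continuous_gauss s)).aestronglyMeasurable
    · simpa using integrable_mul_pow_mul_gauss hκ 0 hs (b := fun y => dunklCos κ (x * y))
        ((continuous_dunklCos hκ).comp (by fun_prop)) (fun y => abs_dunklCos_le_one hκ _)
    · exact (((continuous_dunklSin hκ).comp (by fun_prop)).mul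
        (continuous_id.mul (continuous_gauss s))).neg.aestronglyMeasurable
    · refine Eventually.of_forall fun y x _ => ?_
      rw [norm_neg, norm_mul]
      exact mul_le_of_le_one_left (norm_nonneg _) (abs_dunklSin_le_one hκ _)
    · simpa using (integrable_pow_mul_gauss hκ 1 hs).norm
    · refine Eventually.of_forall fun y x _ => ?_
      have h := ((hasDerivAt_dunklCos hκ (x * y)).comp x
        ((hasDerivAt_id x).mul_const y)).mul_const (gauss s y)
      refine h.congr_deriv ?_
      ring
  have hg : ∀ x, HasDerivAt (fun x => (∫ y, dunklCos κ (x * y) * gauss s y ∂dunklMeasure κ) *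
      gauss (-s⁻¹) x) 0 x := by
    intro x
    refine ((hd x).mul (hasDerivAt_gauss (-s⁻¹) x)).congr_deriv ?_
    field_simp
    ring
  have hc := is_const_of_deriv_eq_zero (fun x => (hg x).differentiableAt)
    (fun x => (hg x).deriv) x 0
  simp only [zero_mul, dunklCos_zero hκ, one_mul, gauss_zero, mul_one] at hc
  rw [← hc, mul_assoc, gauss_mul_gauss]
  simp [gauss]

lemma gauss_dunklMeasure_const {κ : ℝ} (hκ : 0 ≤ κ) {s : ℝ} (hs : 0 < s) :
    mehtaConst κ * ∫ y, gauss s y ∂dunklMeasure κ = s ^ (-(κ + 1 / 2)) := by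
  rw [integral_gauss hs, mehtaConst_eq]
  have := integral_gauss_one_pos hκ
  field_simp

/-- The functions `y ^ j * exp (-s y² / 2)`, `j = 0, 1`. -/
def gaussMonomial (p : {s : ℝ // 0 < s} × Fin 2) (y : ℝ) : ℂ :=
  ((y ^ (p.2 : ℕ) * gauss p.1 y : ℝ) : ℂ)

lemma continuous_gaussMonomial (p : {s : ℝ // 0 < s} × Fin 2) : Continuous (gaussMonomial p) :=
  Complex.continuous_ofReal.comp ((continuous_pow _).mul (continuous_gauss _))

/-- The index of the Dunkl transform of a Gaussian monomial. -/
def gaussIndexInv (p : {s : ℝ // 0 < s} × Fin 2) : {s : ℝ // 0 < s} × Fin 2 :=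
  (⟨(p.1 : ℝ)⁻¹, inv_pos.2 p.1.2⟩, p.2)

/-- The factor in the Dunkl transform of a Gaussian monomial. -/
def gaussFactor (κ : ℝ) (p : {s : ℝ // 0 < s} × Fin 2) : ℂ :=
  (-Complex.I) ^ (p.2 : ℕ) * (((p.1 : ℝ) ^ (-(κ + (p.2 : ℕ) + 1 / 2)) : ℝ) : ℂ)

lemma integrable_gaussMonomial {κ : ℝ} (hκ : 0 ≤ κ) (p : {s : ℝ // 0 < s} × Fin 2) :
    Integrable (gaussMonomial p) (dunklMeasure κ) :=
  (integrable_pow_mul_gauss hκ p.2 p.1.2).ofReal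

lemma integral_dunklSin_mul_gauss_eq_zero {κ : ℝ} (s x : ℝ) :
    ∫ y, dunklSin κ (x * y) * gauss s y ∂dunklMeasure κ = 0 := by
  have h := (measurePreserving_neg_dunklMeasure κ).integral_comp
    (Homeomorph.neg ℝ).measurableEmbedding (fun y => dunklSin κ (x * y) * gauss s y)
  simp only [mul_neg, dunklSin_neg, gauss_neg, neg_mul, integral_neg] at h
  linarith

lemma integral_dunklCos_mul_mul_gauss_eq_zero {κ : ℝ} (s x : ℝ) :
    ∫ y, dunklCos κ (x * y) * (y * gauss s y) ∂dunklMeasure κ = 0 := by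
  have h := (measurePreserving_neg_dunklMeasure κ).integral_comp
    (Homeomorph.neg ℝ).measurableEmbedding (fun y => dunklCos κ (x * y) * (y * gauss s y))
  simp only [mul_neg, dunklCos_neg, gauss_neg, neg_mul, integral_neg] at h
  linarith

/-- Parity leaves only the `dunklCos` integral for `j = 0` and only the `dunklSin` integral for `j =
1`; integration by parts reduces the second to the first. -/
lemma dunklTransform_gaussMonomial {κ : ℝ} (hκ : 0 ≤ κ) (p : {s : ℝ // 0 < s} × Fin 2) (x : ℝ) :
    dunklTransform κ (gaussMonomial p) x = gaussFactor κ p * gaussMonomial (gaussIndexInv p) x := by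
  obtain ⟨⟨s, hs⟩, j⟩ := p
  have hA : Continuous fun y => dunklCos κ (x * y) := (continuous_dunklCos hκ).comp (by fun_prop)
  have hB : Continuous fun y => dunklSin κ (x * y) := (continuous_dunklSin hκ).comp (by fun_prop)
  have hm := gauss_dunklMeasure_const hκ hs
  have e : ∫ y : ℝ, dunklKernel κ (-Complex.I * x) y * gaussMonomial (⟨s, hs⟩, j) y ∂dunklMeasure κ
      = ((∫ y, dunklCos κ (x * y) * (y ^ (j : ℕ) * gauss s y) ∂dunklMeasure κ : ℝ) : ℂ) -
        ((∫ y, dunklSin κ (x * y) * (y ^ (j : ℕ) * gauss s y) ∂dunklMeasure κ : ℝ) : ℂ) *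
          Complex.I := by
    rw [← integral_complex_ofReal, ← integral_complex_ofReal, ← integral_mul_const, ← integral_sub]
    · refine integral_congr_ae (Eventually.of_forall fun y => ?_)
      simp only [dunklKernel_neg_I_mul, gaussMonomial]
      push_cast
      ring
    · exact (integrable_mul_pow_mul_gauss hκ j hs hA (fun y => abs_dunklCos_le_one hκ _)).ofReal
    · exact (integrable_mul_pow_mul_gauss hκ j hs hB
        (fun y => abs_dunklSin_le_one hκ _)).ofReal.mul_const _
  unfold dunklTransform
  rw [e]
  fin_cases j
  · simp only [Fin.zero_eta, Fin.val_zero, pow_zero, one_mul, integral_dunklSin_mul_gauss_eq_zero,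
      integral_dunklCos_mul_gauss hκ hs, gaussFactor, gaussMonomial, gaussIndexInv,
      Nat.cast_zero, add_zero, ← hm]
    push_cast
    ring
  · have h1 := mul_integral_mul_dunklSin_mul_gauss hκ hs x
    rw [integral_dunklCos_mul_gauss hκ hs] at h1
    have h2 : ∫ y, dunklSin κ (x * y) * (y * gauss s y) ∂dunklMeasure κ =
        s⁻¹ * (x * ((∫ y, gauss s y ∂dunklMeasure κ) * gauss s⁻¹ x)) := by
      rw [← h1]; field_simp
    simp only [Fin.mk_one, Fin.val_one, pow_one, integral_dunklCos_mul_mul_gauss_eq_zero, h2,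
      gaussFactor, gaussMonomial, gaussIndexInv, Nat.cast_one]
    rw [show -(κ + 1 + 1 / 2) = -(κ + 1 / 2) - 1 by ring, Real.rpow_sub_one hs.ne', ← hm]
    push_cast
    ring

lemma gaussMonomial_neg (p : {s : ℝ // 0 < s} × Fin 2) (y : ℝ) :
    gaussMonomial p (-y) = (-1) ^ (p.2 : ℕ) * gaussMonomial p y := by
  simp only [gaussMonomial, gauss_neg]
  rw [neg_pow]
  push_cast
  ring

/-- Inversion on a single monomial: the powers of `s` cancel and the square of `-I` leaves the sign
of a reflection. -/
lemma gaussFactor_mul_gaussFactor_inv (κ : ℝ) (p : {s : ℝ // 0 < s} × Fin 2) :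
    gaussFactor κ p * gaussFactor κ (gaussIndexInv p) = (-1) ^ (p.2 : ℕ) := by
  obtain ⟨⟨s, hs⟩, j⟩ := p
  simp only [gaussFactor, gaussIndexInv]
  rw [mul_mul_mul_comm, ← mul_pow, ← Complex.ofReal_mul, ← Real.mul_rpow hs.le (by positivity),
    mul_inv_cancel₀ hs.ne', Real.one_rpow]
  simp

/-- The Dunkl transform preserves the Gram matrix of the Gaussian monomials. -/
lemma integral_gaussMonomial_mul {κ : ℝ} (p q : {s : ℝ // 0 < s} × Fin 2) :
    ∫ y, starRingEnd ℂ (gaussFactor κ p * gaussMonomial (gaussIndexInv p) y) *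
        (gaussFactor κ q * gaussMonomial (gaussIndexInv q) y) ∂dunklMeasure κ =
      ∫ y, starRingEnd ℂ (gaussMonomial p y) * gaussMonomial q y ∂dunklMeasure κ := by
  obtain ⟨⟨s, hs⟩, i⟩ := p
  obtain ⟨⟨t, ht⟩, j⟩ := q
  by_cases hij : i = j
  · subst hij
    have e1 : ∀ y, starRingEnd ℂ (gaussMonomial (⟨s, hs⟩, i) y) * gaussMonomial (⟨t, ht⟩, i) y =
        ((y ^ (2 * (i : ℕ)) * gauss (s + t) y : ℝ) : ℂ) := by
      intro y
      simp only [gaussMonomial, Complex.conj_ofReal, ← gauss_mul_gauss]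
      push_cast
      ring
    have e2 : ∀ y, starRingEnd ℂ (gaussFactor κ (⟨s, hs⟩, i) *
        gaussMonomial (gaussIndexInv (⟨s, hs⟩, i)) y) *
        (gaussFactor κ (⟨t, ht⟩, i) * gaussMonomial (gaussIndexInv (⟨t, ht⟩, i)) y) =
        (((s * t) ^ (-(κ + (i : ℕ) + 1 / 2)) *
          (y ^ (2 * (i : ℕ)) * gauss (s⁻¹ + t⁻¹) y) : ℝ) : ℂ) := by
      intro y
      simp only [gaussMonomial, gaussFactor, gaussIndexInv, map_mul, map_pow, map_neg,
        Complex.conj_ofReal, Complex.conj_I, ← gauss_mul_gauss, neg_neg,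
        Real.mul_rpow hs.le ht.le]
      push_cast
      have : Complex.I ^ (i : ℕ) * (-Complex.I) ^ (i : ℕ) = 1 := by
        rw [← mul_pow]; simp
      linear_combination
        (((s ^ (-(κ + (i : ℕ) + 1 / 2)) : ℝ) : ℂ) * ((t ^ (-(κ + (i : ℕ) + 1 / 2)) : ℝ) : ℂ) *
          ((y : ℂ) ^ (2 * (i : ℕ)) * (gauss s⁻¹ y * gauss t⁻¹ y))) * this
    simp_rw [e1, e2]
    rw [integral_complex_ofReal, integral_complex_ofReal, integral_const_mul,
      integral_pow_mul_gauss (i : ℕ) (add_pos hs ht),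
      integral_pow_mul_gauss (i : ℕ) (add_pos (inv_pos.2 hs) (inv_pos.2 ht)), ← mul_assoc,
      ← Real.mul_rpow (by positivity) (by positivity)]
    -- The exponents agree, and the bases agree because `s t (s⁻¹ + t⁻¹) = s + t`.
    congr 4
    field_simp
    ring
  -- Monomials of opposite parity are orthogonal both before and after the transform.
  · have key : ∀ f : ℝ → ℂ, (∀ y, f (-y) = -f y) → ∫ y, f y ∂dunklMeasure κ = 0 := by
      intro f hf
      have h := (measurePreserving_neg_dunklMeasure κ).integral_comp
        (Homeomorph.neg ℝ).measurableEmbedding f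
      simp only [hf, integral_neg] at h
      exact self_eq_neg.1 h.symm
    have hsgn : ((-1 : ℂ) ^ (i : ℕ)) * (-1) ^ (j : ℕ) = -1 := by
      fin_cases i <;> fin_cases j <;> simp_all
    rw [key, key]
    · intro y
      rw [gaussMonomial_neg, gaussMonomial_neg]
      simp only [map_mul, map_pow, map_neg, map_one]
      linear_combination (starRingEnd ℂ (gaussMonomial (⟨s, hs⟩, i) y) *
        gaussMonomial (⟨t, ht⟩, j) y) * hsgn
    · intro y
      rw [gaussMonomial_neg, gaussMonomial_neg]
      simp only [map_mul, map_pow, map_neg, map_one, gaussIndexInv]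
      linear_combination (starRingEnd ℂ (gaussFactor κ (⟨s, hs⟩, i)) *
        starRingEnd ℂ (gaussMonomial (⟨s⁻¹, inv_pos.2 hs⟩, i) y) *
        (gaussFactor κ (⟨t, ht⟩, j) * gaussMonomial (⟨t⁻¹, inv_pos.2 ht⟩, j) y)) * hsgn

lemma integral_dunklMeasure_comp_neg {E : Type*} [NormedAddCommGroup E] [NormedSpace ℝ E]
    (κ : ℝ) (f : ℝ → E) : ∫ y, f (-y) ∂dunklMeasure κ = ∫ y, f y ∂dunklMeasure κ :=
  (measurePreserving_neg_dunklMeasure κ).integral_comp (Homeomorph.neg ℝ).measurableEmbedding f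

lemma _root_.MeasureTheory.Integrable.comp_neg_dunklMeasure {E : Type*} [NormedAddCommGroup E]
    {κ : ℝ} {f : ℝ → E} (hf : Integrable f (dunklMeasure κ)) :
    Integrable (fun y => f (-y)) (dunklMeasure κ) :=
  (measurePreserving_neg_dunklMeasure κ).integrable_comp_of_integrable hf

/-! ### Gaussian monomials determine a function -/

/-- A compactly supported even function is a continuous function of a Gaussian. -/
lemma exists_continuous_comp_gauss {g : ℝ → ℝ} (hg : Continuous g) (hs : HasCompactSupport g)
    (he : ∀ y, g (-y) = g y) : ∃ ψ : ℝ → ℝ, Continuous ψ ∧ ∀ y, g y = ψ (gauss 1 y) := by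
  obtain ⟨R, hR⟩ := hs.isCompact.isBounded.subset_closedBall 0
  have h0 : ∀ y, R < |y| → g y = 0 := by
    intro y hy
    by_contra hne
    have := hR (subset_tsupport g hne)
    rw [mem_closedBall_zero_iff, Real.norm_eq_abs] at this
    linarith
  set δ := gauss 1 (|R| + 1)
  have hδ : 0 < δ := gauss_pos _ _
  have key : ∀ y, √(-2 * Real.log (gauss 1 y)) = |y| := by
    intro y
    rw [gauss, Real.log_exp, ← Real.sqrt_sq_eq_abs]
    ring_nf
  -- `√(-2 log q)` recovers `|y|` from `q = gauss 1 y`. Truncating at `δ` keeps the logarithm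
  -- continuous near `q = 0`, and below `δ` the function `g` already vanishes.
  refine ⟨fun q => g √(-2 * Real.log (max q δ)), ?_, fun y => ?_⟩
  · refine hg.comp (Real.continuous_sqrt.comp (continuous_const.mul ?_))
    exact Continuous.log (by fun_prop) fun q => (lt_max_of_lt_right hδ).ne'
  · have habs : ∀ y, g |y| = g y := fun y => by
      rcases abs_choice y with h | h <;> rw [h]
      exact he y
    rcases le_total δ (gauss 1 y) with h | h
    · simp only [max_eq_left h, key, habs]
    · have h1 : |R| + 1 ≤ |y| := by
        have h2 : (|R| + 1) ^ 2 ≤ y ^ 2 := by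
          have := Real.exp_le_exp.1 h
          linarith
        rw [← abs_of_nonneg (show 0 ≤ |R| + 1 by positivity)]
        exact sq_le_sq.1 h2
      have h3 := le_abs_self R
      simp only [max_eq_right h, δ, key, habs]
      rw [h0 y (by linarith), h0 _ (by rw [abs_of_nonneg] <;> [linarith; positivity])]

lemma gauss_one_pow (n : ℕ) (y : ℝ) : gauss 1 y * gauss 1 y ^ n = gauss (n + 1) y := by
  unfold gauss
  rw [← Real.exp_nat_mul, ← Real.exp_add]
  ring_nf

/-- Powers of `gauss 1` times `gauss 1` are again Gaussians, so the hypothesis covers every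
polynomial `ψ`. Weierstrass approximation on `[0, 1]`, where `gauss 1` takes its values, gives the
rest. -/
lemma integral_mul_comp_gauss_eq_zero {κ : ℝ} {k : ℝ → ℂ}
    (hk : Integrable (fun y => k y * gauss 1 y) (dunklMeasure κ))
    (h0 : ∀ n : ℕ, ∫ y, k y * gauss (n + 1) y ∂dunklMeasure κ = 0) {ψ : ℝ → ℝ}
    (hψ : Continuous ψ) :
    ∫ y, ψ (gauss 1 y) * (k y * gauss 1 y) ∂dunklMeasure κ = 0 := by
  have hmem : ∀ y, gauss 1 y ∈ Icc (0 : ℝ) 1 := fun y =>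
    ⟨(gauss_pos 1 y).le, gauss_le_one zero_le_one y⟩
  have hint : ∀ φ : ℝ → ℝ, Continuous φ →
      Integrable (fun y => (φ (gauss 1 y) : ℂ) * (k y * gauss 1 y)) (dunklMeasure κ) := by
    intro φ hφ
    obtain ⟨C, hC⟩ := isCompact_Icc.exists_bound_of_continuousOn (hφ.continuousOn (s := Icc 0 1))
    exact hk.bdd_mul (c := C)
      (Complex.continuous_ofReal.comp (hφ.comp (continuous_gauss 1))).aestronglyMeasurable
      (Eventually.of_forall fun y => by simpa using hC _ (hmem y))
  have hpoly : ∀ p : Polynomial ℝ,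
      ∫ y, ((p.eval (gauss 1 y) : ℝ) : ℂ) * (k y * gauss 1 y) ∂dunklMeasure κ = 0 := by
    intro p
    induction p using Polynomial.induction_on' with
    | add p q hp hq =>
      simp only [Polynomial.eval_add, Complex.ofReal_add, add_mul]
      rw [integral_add (hint _ p.continuous) (hint _ q.continuous), hp, hq, add_zero]
    | monomial n a =>
      have e : ∀ y, (((Polynomial.monomial n a).eval (gauss 1 y) : ℝ) : ℂ) * (k y * gauss 1 y) =
          a * (k y * gauss (n + 1) y) := by
        intro y
        rw [← gauss_one_pow, Polynomial.eval_monomial]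
        push_cast
        ring
      simp_rw [e]
      rw [integral_const_mul, h0, mul_zero]
  rw [← norm_le_zero_iff]
  refine le_of_forall_pos_le_add fun ε hε => ?_
  set K := ∫ y, ‖k y * gauss 1 y‖ ∂dunklMeasure κ
  have hK : 0 ≤ K := integral_nonneg fun y => norm_nonneg _
  obtain ⟨p, hp⟩ := exists_polynomial_near_of_continuousOn 0 1 ψ hψ.continuousOn
    (ε / (K + 1)) (by positivity)
  have e : ∫ y, (ψ (gauss 1 y) : ℂ) * (k y * gauss 1 y) ∂dunklMeasure κ =
      ∫ y, ((ψ (gauss 1 y) - p.eval (gauss 1 y) : ℝ) : ℂ) * (k y * gauss 1 y) ∂dunklMeasure κ := by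
    simp only [Complex.ofReal_sub, sub_mul]
    rw [integral_sub (hint _ hψ) (hint _ p.continuous), hpoly, sub_zero]
  rw [e]
  calc _ ≤ ∫ y, ‖((ψ (gauss 1 y) - p.eval (gauss 1 y) : ℝ) : ℂ) * (k y * gauss 1 y)‖
        ∂dunklMeasure κ := norm_integral_le_integral_norm _
    _ ≤ ∫ y, ε / (K + 1) * ‖k y * gauss 1 y‖ ∂dunklMeasure κ := by
      refine integral_mono (hint _ (hψ.sub p.continuous)).norm (hk.norm.const_mul _) fun y => ?_
      simp only
      rw [norm_mul]
      gcongr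
      rw [Complex.norm_real, Real.norm_eq_abs, abs_sub_comm]
      exact (hp _ (hmem y)).le
    _ = ε / (K + 1) * K := integral_const_mul _ _
    _ ≤ 0 + ε := by
      rw [zero_add, div_mul_eq_mul_div, div_le_iff₀ (by positivity)]
      nlinarith

/-- Gaussians separate the even parts of functions. -/
lemma ae_add_comp_neg_eq_zero {κ : ℝ} {k : ℝ → ℂ}
    (hk : Integrable (fun y => k y * gauss 1 y) (dunklMeasure κ))
    (h0 : ∀ n : ℕ, ∫ y, k y * gauss (n + 1) y ∂dunklMeasure κ = 0) :
    ∀ᵐ y ∂dunklMeasure κ, k y + k (-y) = 0 := by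
  have hk' : Integrable (fun y => k (-y) * gauss 1 y) (dunklMeasure κ) := by
    simpa [gauss_neg] using hk.comp_neg_dunklMeasure
  have hf : Integrable (fun y => (k y + k (-y)) * gauss 1 y) (dunklMeasure κ) :=
    (hk.add hk').congr (Eventually.of_forall fun y => by simp [add_mul])
  have key : ∀ g : ℝ → ℝ, Continuous g → HasCompactSupport g →
      ∫ y, g y • ((k y + k (-y)) * gauss 1 y) ∂dunklMeasure κ = 0 := by
    intro g hg hgs
    obtain ⟨C, hC⟩ := hgs.exists_bound_of_continuous hg
    have hg' : AEStronglyMeasurable (fun y => (g y : ℂ)) (dunklMeasure κ) :=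
      (Complex.continuous_ofReal.comp hg).aestronglyMeasurable
    have hC' : ∀ y, ‖(g y : ℂ)‖ ≤ C := fun y => by simpa using hC y
    have i1 : Integrable (fun y => (g y : ℂ) * (k y * gauss 1 y)) (dunklMeasure κ) :=
      hk.bdd_mul hg' (Eventually.of_forall hC')
    have i2 : Integrable (fun y => (g y : ℂ) * (k (-y) * gauss 1 y)) (dunklMeasure κ) :=
      hk'.bdd_mul hg' (Eventually.of_forall hC')
    have i3 : Integrable (fun y => (g (-y) : ℂ) * (k y * gauss 1 y)) (dunklMeasure κ) := by
      simpa [gauss_neg] using i2.comp_neg_dunklMeasure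
    have e2 := integral_dunklMeasure_comp_neg κ (fun y => (g y : ℂ) * (k (-y) * gauss 1 y))
    simp only [neg_neg, gauss_neg] at e2
    -- A reflection moves the symmetrization from `k` to the test function; `g + g ∘ neg` is even,
    -- hence a function of the Gaussian.
    obtain ⟨ψ, hψ, hψg⟩ := exists_continuous_comp_gauss (g := fun y => g y + g (-y))
      (hg.add (hg.comp continuous_neg))
      (hgs.add (hgs.comp_homeomorph (Homeomorph.neg ℝ))) (fun y => by simp [add_comm])
    have e1 : ∀ y, g y • ((k y + k (-y)) * gauss 1 y) =
        (g y : ℂ) * (k y * gauss 1 y) + (g y : ℂ) * (k (-y) * gauss 1 y) := fun y => by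
      rw [Complex.real_smul]; ring
    simp_rw [e1]
    rw [integral_add i1 i2, ← e2, ← integral_add i1 i3, ← integral_mul_comp_gauss_eq_zero hk h0 hψ]
    refine integral_congr_ae (Eventually.of_forall fun y => ?_)
    simp only [← hψg]
    push_cast
    ring
  have := ae_eq_zero_of_integral_contDiff_smul_eq_zero hf.locallyIntegrable
    (fun g hg hgs => key g hg.continuous hgs)
  filter_upwards [this] with y hy
  have hg : (gauss 1 y : ℂ) ≠ 0 := by exact_mod_cast (gauss_pos 1 y).ne'
  exact (mul_eq_zero.1 hy).resolve_right hg

/-- Gaussian monomials separate functions. -/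
lemma ae_eq_zero_of_integral_mul_gaussMonomial {κ : ℝ} {k : ℝ → ℂ}
    (hk : ∀ p, Integrable (fun y => k y * gaussMonomial p y) (dunklMeasure κ))
    (h0 : ∀ p, ∫ y, k y * gaussMonomial p y ∂dunklMeasure κ = 0) :
    k =ᵐ[dunklMeasure κ] 0 := by
  have h1 := ae_add_comp_neg_eq_zero (k := k)
    (by simpa [gaussMonomial] using hk (⟨1, one_pos⟩, 0))
    (fun n => by simpa [gaussMonomial] using h0 (⟨n + 1, by positivity⟩, 0))
  -- The even part of `y * k y` is `y` times the odd part of `k`, so both parts of `k` vanish away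
  -- from the null set `{0}`.
  have h2 := ae_add_comp_neg_eq_zero (k := fun y => k y * y)
    (by simpa [gaussMonomial, mul_assoc] using hk (⟨1, one_pos⟩, 1))
    (fun n => by simpa [gaussMonomial, mul_assoc] using h0 (⟨n + 1, by positivity⟩, 1))
  have h3 : ∀ᵐ y ∂dunklMeasure κ, y ≠ 0 := by simp [ae_iff]
  filter_upwards [h1, h2, h3] with y hy1 hy2 hy3
  have hy : (y : ℂ) ≠ 0 := by exact_mod_cast hy3
  have h4 : 2 * k y * (y : ℂ) = 0 := by
    push_cast at hy2
    linear_combination hy2 + (y : ℂ) * hy1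
  simpa [hy] using h4

/-! ### The transform as an isometry of `L²` -/

lemma memLp_gaussMonomial {κ : ℝ} (hκ : 0 ≤ κ) (p : {s : ℝ // 0 < s} × Fin 2) :
    MemLp (gaussMonomial p) 2 (dunklMeasure κ) := by
  rw [memLp_two_iff_integrable_sq_norm (continuous_gaussMonomial p).aestronglyMeasurable]
  obtain ⟨⟨s, hs⟩, j⟩ := p
  refine (integrable_pow_mul_gauss hκ (2 * (j : ℕ)) (add_pos hs hs)).congr
    (Eventually.of_forall fun y => ?_)
  simp only [gaussMonomial, Complex.norm_real, Real.norm_eq_abs, sq_abs, ← gauss_mul_gauss]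
  ring

/-- The Gaussian monomials as elements of `L²`. -/
def gaussVec {κ : ℝ} (hκ : 0 ≤ κ) (p : {s : ℝ // 0 < s} × Fin 2) : Lp ℂ 2 (dunklMeasure κ) :=
  (memLp_gaussMonomial hκ p).toLp

lemma coeFn_gaussVec {κ : ℝ} (hκ : 0 ≤ κ) (p : {s : ℝ // 0 < s} × Fin 2) :
    gaussVec hκ p =ᵐ[dunklMeasure κ] gaussMonomial p := (memLp_gaussMonomial hκ p).coeFn_toLp

lemma inner_gaussVec {κ : ℝ} (hκ : 0 ≤ κ) (p : {s : ℝ // 0 < s} × Fin 2)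
    (f : Lp ℂ 2 (dunklMeasure κ)) :
    inner ℂ (gaussVec hκ p) f = ∫ y, f y * gaussMonomial p y ∂dunklMeasure κ := by
  rw [L2.inner_def]
  refine integral_congr_ae ?_
  filter_upwards [coeFn_gaussVec hκ p] with y hy
  rw [hy]
  simp [gaussMonomial]

lemma _root_.MeasureTheory.MemLp.integrable_mul_gaussMonomial {κ : ℝ} (hκ : 0 ≤ κ) {f : ℝ → ℂ}
    (hf : MemLp f 2 (dunklMeasure κ)) (p : {s : ℝ // 0 < s} × Fin 2) :
    Integrable (fun y => f y * gaussMonomial p y) (dunklMeasure κ) :=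
  hf.integrable_mul (memLp_gaussMonomial hκ p)

lemma dense_span_gaussVec {κ : ℝ} (hκ : 0 ≤ κ) :
    Dense (Submodule.span ℂ (range (gaussVec hκ)) : Set (Lp ℂ 2 (dunklMeasure κ))) := by
  rw [Submodule.dense_iff_topologicalClosure_eq_top, Submodule.topologicalClosure_eq_top_iff,
    Submodule.eq_bot_iff]
  intro f hf
  have h0 : ∀ p, inner ℂ (gaussVec hκ p) f = 0 := fun p =>
    (Submodule.mem_orthogonal _ _).1 hf _ (Submodule.subset_span ⟨p, rfl⟩)
  have := ae_eq_zero_of_integral_mul_gaussMonomial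
    (fun p => (Lp.memLp f).integrable_mul_gaussMonomial hκ p)
    (fun p => by rw [← inner_gaussVec hκ, h0])
  exact (Lp.eq_zero_iff_ae_eq_zero).2 this

/-- The Dunkl transform of the Gaussian monomials, as elements of `L²`. -/
def gaussVecTransform {κ : ℝ} (hκ : 0 ≤ κ) (p : {s : ℝ // 0 < s} × Fin 2) :
    Lp ℂ 2 (dunklMeasure κ) := gaussFactor κ p • gaussVec hκ (gaussIndexInv p)

lemma inner_gaussVecTransform {κ : ℝ} (hκ : 0 ≤ κ) (p q : {s : ℝ // 0 < s} × Fin 2) :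
    inner ℂ (gaussVecTransform hκ p) (gaussVecTransform hκ q) =
      inner ℂ (gaussVec hκ p) (gaussVec hκ q) := by
  have h := integral_gaussMonomial_mul (κ := κ) p q
  rw [L2.inner_def, L2.inner_def]
  convert h using 1
  · refine integral_congr_ae ?_
    filter_upwards [coeFn_gaussVec hκ (gaussIndexInv p), coeFn_gaussVec hκ (gaussIndexInv q),
      Lp.coeFn_smul (gaussFactor κ p) (gaussVec hκ (gaussIndexInv p)),
      Lp.coeFn_smul (gaussFactor κ q) (gaussVec hκ (gaussIndexInv q))] with y h1 h2 h3 h4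
    simp only [gaussVecTransform]
    rw [h3, h4, Pi.smul_apply, Pi.smul_apply, h1, h2, RCLike.inner_apply, smul_eq_mul, smul_eq_mul]
    ring
  · refine integral_congr_ae ?_
    filter_upwards [coeFn_gaussVec hκ p, coeFn_gaussVec hκ q] with y h1 h2
    rw [h1, h2, RCLike.inner_apply, mul_comm]

/-- Equality of Gram matrices gives equality of norms for all finite combinations. Prescribing the
transform on Gaussian monomials is thus consistent, with no need for their linear independence, and
it extends from the dense span. -/
lemma norm_linearCombination_gaussVecTransform {κ : ℝ} (hκ : 0 ≤ κ)
    (x : ({s : ℝ // 0 < s} × Fin 2) →₀ ℂ) :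
    ‖Finsupp.linearCombination ℂ (gaussVecTransform hκ) x‖ =
      ‖Finsupp.linearCombination ℂ (gaussVec hκ) x‖ := by
  have h : inner ℂ (Finsupp.linearCombination ℂ (gaussVecTransform hκ) x)
        (Finsupp.linearCombination ℂ (gaussVecTransform hκ) x) =
      inner ℂ (Finsupp.linearCombination ℂ (gaussVec hκ) x)
        (Finsupp.linearCombination ℂ (gaussVec hκ) x) := by
    simp only [Finsupp.linearCombination_apply, Finsupp.sum, sum_inner, inner_sum, inner_smul_left,
      inner_smul_right, inner_gaussVecTransform]
  rw [@norm_eq_sqrt_re_inner ℂ, @norm_eq_sqrt_re_inner ℂ, h]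

lemma denseRange_linearCombination_gaussVec {κ : ℝ} (hκ : 0 ≤ κ) :
    DenseRange (Finsupp.linearCombination ℂ (gaussVec hκ)) := by
  have h := dense_span_gaussVec hκ
  rw [← Finsupp.range_linearCombination] at h
  exact h

/-- The Dunkl transform as an isometry of `L²`. -/
def dunklL2 {κ : ℝ} (hκ : 0 ≤ κ) :
    Lp ℂ 2 (dunklMeasure κ) →ₗᵢ[ℂ] Lp ℂ 2 (dunklMeasure κ) where
  toLinearMap := (Finsupp.linearCombination ℂ (gaussVecTransform hκ)).extendOfNorm
    (Finsupp.linearCombination ℂ (gaussVec hκ))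
  norm_map' f := by
    refine (denseRange_linearCombination_gaussVec hκ).induction_on f
      (isClosed_eq (ContinuousLinearMap.continuous _).norm continuous_norm) fun x => ?_
    rw [ContinuousLinearMap.coe_coe, LinearMap.extendOfNorm_eq (denseRange_linearCombination_gaussVec hκ)
      ⟨1, fun x => by rw [norm_linearCombination_gaussVecTransform, one_mul]⟩]
    exact norm_linearCombination_gaussVecTransform hκ x

lemma dunklL2_gaussVec {κ : ℝ} (hκ : 0 ≤ κ) (p : {s : ℝ // 0 < s} × Fin 2) :
    dunklL2 hκ (gaussVec hκ p) = gaussFactor κ p • gaussVec hκ (gaussIndexInv p) := by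
  have h := LinearMap.extendOfNorm_eq (f := Finsupp.linearCombination ℂ (gaussVecTransform hκ))
    (denseRange_linearCombination_gaussVec hκ)
    ⟨1, fun x => by rw [norm_linearCombination_gaussVecTransform, one_mul]⟩ (Finsupp.single p 1)
  simp only [Finsupp.linearCombination_single, one_smul] at h
  exact h

/-- The reflection `f ↦ f(-·)` on `L²`. -/
def reflL2 (κ : ℝ) : Lp ℂ 2 (dunklMeasure κ) →ₗᵢ[ℂ] Lp ℂ 2 (dunklMeasure κ) :=
  Lp.compMeasurePreservingₗᵢ ℂ _ (measurePreserving_neg_dunklMeasure κ)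

lemma coeFn_reflL2 {κ : ℝ} (f : Lp ℂ 2 (dunklMeasure κ)) :
    reflL2 κ f =ᵐ[dunklMeasure κ] fun y => f (-y) :=
  Lp.coeFn_compMeasurePreserving f (measurePreserving_neg_dunklMeasure κ)

lemma ae_neg_of_ae {κ : ℝ} {p : ℝ → Prop} (h : ∀ᵐ y ∂dunklMeasure κ, p y) :
    ∀ᵐ y ∂dunklMeasure κ, p (-y) :=
  (measurePreserving_neg_dunklMeasure κ).quasiMeasurePreserving.ae h

lemma reflL2_gaussVec {κ : ℝ} (hκ : 0 ≤ κ) (p : {s : ℝ // 0 < s} × Fin 2) :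
    reflL2 κ (gaussVec hκ p) = (-1 : ℂ) ^ (p.2 : ℕ) • gaussVec hκ p := by
  ext1
  filter_upwards [coeFn_reflL2 (gaussVec hκ p), coeFn_gaussVec hκ p,
    ae_neg_of_ae (coeFn_gaussVec hκ p),
    Lp.coeFn_smul ((-1 : ℂ) ^ (p.2 : ℕ)) (gaussVec hκ p)] with y h1 h2 h3 h4
  rw [h1, h3, h4, Pi.smul_apply, h2, gaussMonomial_neg, smul_eq_mul]

/-- Inversion, checked on the dense span of the Gaussian monomials. It shows that `dunklL2` is onto,
with inverse `dunklL2` after `reflL2`. -/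
lemma dunklL2_dunklL2 {κ : ℝ} (hκ : 0 ≤ κ) (f : Lp ℂ 2 (dunklMeasure κ)) :
    dunklL2 hκ (dunklL2 hκ f) = reflL2 κ f := by
  have h : (dunklL2 hκ).toContinuousLinearMap.comp (dunklL2 hκ).toContinuousLinearMap =
      (reflL2 κ).toContinuousLinearMap := by
    refine ContinuousLinearMap.ext_on (dense_span_gaussVec hκ) ?_
    rintro _ ⟨p, rfl⟩
    simp only [ContinuousLinearMap.comp_apply, LinearIsometry.coe_toContinuousLinearMap,
      dunklL2_gaussVec, map_smul, smul_smul, gaussFactor_mul_gaussFactor_inv, reflL2_gaussVec]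
    congr 2
    simp [gaussIndexInv]
  exact congrArg (fun T => T f) h

lemma reflL2_reflL2 {κ : ℝ} (f : Lp ℂ 2 (dunklMeasure κ)) : reflL2 κ (reflL2 κ f) = f := by
  ext1
  filter_upwards [coeFn_reflL2 (reflL2 κ f), ae_neg_of_ae (coeFn_reflL2 f)] with y h1 h2
  rw [h1, h2, neg_neg]

/-- By inversion `gaussVec hκ p` is a double transform of its reflection, and the isometry strips
one transform from both entries. This is the `L²` counterpart of `integral_dunklTransform_mul`. -/
lemma inner_gaussVec_dunklL2 {κ : ℝ} (hκ : 0 ≤ κ) (p : {s : ℝ // 0 < s} × Fin 2)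
    (f : Lp ℂ 2 (dunklMeasure κ)) :
    inner ℂ (gaussVec hκ p) (dunklL2 hκ f) =
      gaussFactor κ p * inner ℂ (gaussVec hκ (gaussIndexInv p)) f := by
  have e : gaussVec hκ p = dunklL2 hκ (dunklL2 hκ (reflL2 κ (gaussVec hκ p))) := by
    rw [dunklL2_dunklL2, reflL2_reflL2]
  rw [e, LinearIsometry.inner_map_map, reflL2_gaussVec, map_smul, dunklL2_gaussVec,
    inner_smul_left, inner_smul_left, ← mul_assoc]
  congr 1
  simp only [gaussFactor, map_mul, map_pow, map_neg, map_one, Complex.conj_I, Complex.conj_ofReal]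
  rw [← mul_assoc, ← mul_pow]
  simp

lemma dunklKernel_neg_I_mul_comm (κ x y : ℝ) :
    dunklKernel κ (-Complex.I * x) y = dunklKernel κ (-Complex.I * y) x := by
  rw [dunklKernel_neg_I_mul, dunklKernel_neg_I_mul, mul_comm]

/-! ### The integral transform agrees with the `L²` transform -/

section Transform

variable {κ : ℝ} {u v : ℝ → ℂ}

lemma integrable_dunklKernel_mul (hκ : 0 ≤ κ) (hu : Integrable u (dunklMeasure κ)) (x : ℝ) :
    Integrable (fun y : ℝ => dunklKernel κ (-Complex.I * x) y * u y) (dunklMeasure κ) :=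
  hu.bdd_mul (c := 1) ((continuous_dunklKernel_neg_I_mul hκ).comp
    (f := fun y : ℝ => (x, y)) (by fun_prop)).aestronglyMeasurable
    (Eventually.of_forall fun y => norm_dunklKernel_neg_I_mul_le hκ x y)

lemma continuous_dunklTransform (hκ : 0 ≤ κ) (hu : Integrable u (dunklMeasure κ)) :
    Continuous (dunklTransform κ u) := by
  refine continuous_const.mul (continuous_of_dominated (bound := fun y => ‖u y‖)
    (fun x => (integrable_dunklKernel_mul hκ hu x).aestronglyMeasurable)
    (fun x => Eventually.of_forall fun y => ?_) hu.norm (Eventually.of_forall fun y => ?_))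
  · rw [norm_mul]
    exact mul_le_of_le_one_left (norm_nonneg _) (norm_dunklKernel_neg_I_mul_le hκ x y)
  · exact ((continuous_dunklKernel_neg_I_mul hκ).comp
      (f := fun x : ℝ => (x, y)) (by fun_prop)).mul continuous_const

lemma norm_dunklTransform_le (hκ : 0 ≤ κ) (hu : Integrable u (dunklMeasure κ)) (x : ℝ) :
    ‖dunklTransform κ u x‖ ≤ mehtaConst κ * ∫ y, ‖u y‖ ∂dunklMeasure κ := by
  unfold dunklTransform
  rw [norm_mul, Complex.norm_real, Real.norm_of_nonneg (mehtaConst_pos hκ).le]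
  refine mul_le_mul_of_nonneg_left ?_ (mehtaConst_pos hκ).le
  refine (norm_integral_le_integral_norm _).trans
    (integral_mono (integrable_dunklKernel_mul hκ hu x).norm hu.norm fun y => ?_)
  simp only
  rw [norm_mul]
  exact mul_le_of_le_one_left (norm_nonneg _) (norm_dunklKernel_neg_I_mul_le hκ x y)

/-- The multiplication formula: Fubini and the symmetry of the kernel, which is bounded by `1`. -/
lemma integral_dunklTransform_mul (hκ : 0 ≤ κ) (hu : Integrable u (dunklMeasure κ))
    (hv : Integrable v (dunklMeasure κ)) :
    ∫ x, dunklTransform κ u x * v x ∂dunklMeasure κ =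
      ∫ y, u y * dunklTransform κ v y ∂dunklMeasure κ := by
  have hi : Integrable (Function.uncurry fun x y : ℝ =>
      dunklKernel κ (-Complex.I * x) y * (v x * u y)) ((dunklMeasure κ).prod (dunklMeasure κ)) :=
    (hv.mul_prod hu).bdd_mul (c := 1) (continuous_dunklKernel_neg_I_mul hκ).aestronglyMeasurable
      (Eventually.of_forall fun p => norm_dunklKernel_neg_I_mul_le hκ p.1 p.2)
  have h := integral_integral_swap hi
  have e1 : ∀ x, dunklTransform κ u x * v x = (mehtaConst κ : ℂ) *
      ∫ y : ℝ, dunklKernel κ (-Complex.I * x) y * (v x * u y) ∂dunklMeasure κ := by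
    intro x
    unfold dunklTransform
    rw [mul_assoc, ← integral_mul_const]
    congr 2 with y
    ring
  have e2 : ∀ y, u y * dunklTransform κ v y = (mehtaConst κ : ℂ) *
      ∫ x : ℝ, dunklKernel κ (-Complex.I * x) y * (v x * u y) ∂dunklMeasure κ := by
    intro y
    unfold dunklTransform
    rw [mul_left_comm, ← integral_const_mul]
    congr 2 with x
    rw [dunklKernel_neg_I_mul_comm κ x y]
    ring
  simp_rw [e1, e2]
  rw [integral_const_mul, integral_const_mul, h]

/-- On `L¹ ∩ L²` the `L²` transform is given by the integral. -/
lemma dunklTransform_ae_eq_dunklL2 (hκ : 0 ≤ κ) (hu : Integrable u (dunklMeasure κ))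
    (hu2 : MemLp u 2 (dunklMeasure κ)) :
    dunklTransform κ u =ᵐ[dunklMeasure κ] dunklL2 hκ hu2.toLp := by
  have i1 : ∀ p, Integrable (fun y => dunklTransform κ u y * gaussMonomial p y) (dunklMeasure κ) :=
    fun p => (integrable_gaussMonomial hκ p).bdd_mul
      (continuous_dunklTransform hκ hu).aestronglyMeasurable
      (Eventually.of_forall (norm_dunklTransform_le hκ hu))
  have i2 := fun p => (Lp.memLp (dunklL2 hκ hu2.toLp)).integrable_mul_gaussMonomial hκ p
  -- Test both sides against each Gaussian monomial. The multiplication formula on the left and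
  -- `inner_gaussVec_dunklL2` on the right both leave `u` integrated against the transform of that
  -- monomial.
  have h := ae_eq_zero_of_integral_mul_gaussMonomial
    (k := fun y => dunklTransform κ u y - dunklL2 hκ hu2.toLp y)
    (fun p => ((i1 p).sub (i2 p)).congr (Eventually.of_forall fun y => by simp [sub_mul]))
    (fun p => by
      simp only [sub_mul]
      rw [integral_sub (i1 p) (i2 p), ← inner_gaussVec hκ, inner_gaussVec_dunklL2,
        integral_dunklTransform_mul hκ hu (integrable_gaussMonomial hκ p), inner_gaussVec,
        ← integral_const_mul, sub_eq_zero]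
      refine integral_congr_ae ?_
      filter_upwards [hu2.coeFn_toLp] with y hy
      rw [hy, dunklTransform_gaussMonomial hκ]
      ring)
  filter_upwards [h] with y hy
  exact sub_eq_zero.1 hy

end Transform

/-! ### The Dunkl translation on `L²` -/

section

variable {κ : ℝ} {f F g : ℝ → ℂ}

lemma eLpNorm_dunklTransform_sub (hκ : 0 ≤ κ) {u : ℝ → ℂ} (hu : Integrable u (dunklMeasure κ))
    (hu2 : MemLp u 2 (dunklMeasure κ)) (hF : MemLp F 2 (dunklMeasure κ)) :
    eLpNorm (dunklTransform κ u - F) 2 (dunklMeasure κ) =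
      edist (dunklL2 hκ hu2.toLp) hF.toLp := by
  rw [Lp.edist_def]
  refine eLpNorm_congr_ae ?_
  exact (dunklTransform_ae_eq_dunklL2 hκ hu hu2).sub hF.coeFn_toLp.symm

lemma exists_seq_memLp_one_tendsto (hκ : 0 ≤ κ) (hf : MemLp f 2 (dunklMeasure κ)) :
    ∃ u : ℕ → ℝ → ℂ,
      (∀ k, MemLp (u k) 1 (dunklMeasure κ) ∧ MemLp (u k) 2 (dunklMeasure κ)) ∧
      Tendsto (fun k => eLpNorm (u k - f) 2 (dunklMeasure κ)) atTop (𝓝 0) := by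
  have := isLocallyFiniteMeasure_dunklMeasure hκ
  have h : ∀ k : ℕ, ∃ g : ℝ → ℂ, (MemLp g 1 (dunklMeasure κ) ∧ MemLp g 2 (dunklMeasure κ)) ∧
      eLpNorm (g - f) 2 (dunklMeasure κ) ≤ ((k : ℝ≥0∞) + 1)⁻¹ := by
    intro k
    obtain ⟨g, hs, hle, hc, hg⟩ := hf.exists_hasCompactSupport_eLpNorm_sub_le (by simp)
      (ε := ((k : ℝ≥0∞) + 1)⁻¹) (by simp)
    exact ⟨g, ⟨hc.memLp_of_hasCompactSupport hs, hg⟩, by rwa [eLpNorm_sub_comm]⟩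
  choose u hu hle using h
  refine ⟨u, hu, tendsto_of_tendsto_of_tendsto_of_le_of_le tendsto_const_nhds ?_
    (fun _ => zero_le) hle⟩
  have := (ENNReal.tendsto_inv_nat_nhds_zero).comp (tendsto_add_atTop_nat 1)
  simpa [Function.comp_def] using this

/-- The integral transform agrees with `dunklL2` on `L¹ ∩ L²`, which is dense, so continuity turns
the limit definition into the graph of the isometry. In particular the transform is unique up to
null sets. -/
lemma isDunklTransformL2_iff (hκ : 0 ≤ κ) (hf : MemLp f 2 (dunklMeasure κ)) :
    IsDunklTransformL2 κ f F ↔ F =ᵐ[dunklMeasure κ] dunklL2 hκ hf.toLp := by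
  constructor
  · rintro ⟨-, hF, u, hu, h1, h2⟩
    have t1 : Tendsto (fun k => (hu k).2.toLp) atTop (𝓝 hf.toLp) := by
      rw [tendsto_iff_edist_tendsto_0]
      simpa only [Lp.edist_toLp_toLp] using h1
    have t2 : Tendsto (fun k => dunklL2 hκ (hu k).2.toLp) atTop (𝓝 hF.toLp) := by
      rw [tendsto_iff_edist_tendsto_0]
      simpa only [eLpNorm_dunklTransform_sub hκ (memLp_one_iff_integrable.1 (hu _).1) (hu _).2 hF]
        using h2
    have t3 := ((dunklL2 hκ).continuous.tendsto _).comp t1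
    rw [← tendsto_nhds_unique t2 t3]
    exact hF.coeFn_toLp.symm
  · intro h
    have hF : MemLp F 2 (dunklMeasure κ) := (Lp.memLp _).ae_eq h.symm
    obtain ⟨u, hu, h1⟩ := exists_seq_memLp_one_tendsto hκ hf
    refine ⟨hf, hF, u, hu, h1, ?_⟩
    have e : hF.toLp = dunklL2 hκ hf.toLp := by
      ext1
      exact hF.coeFn_toLp.trans h
    simp only [eLpNorm_dunklTransform_sub hκ (memLp_one_iff_integrable.1 (hu _).1) (hu _).2 hF, e,
      (dunklL2 hκ).isometry.edist_eq, Lp.edist_toLp_toLp]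
    exact h1

lemma _root_.MeasureTheory.MemLp.dunklKernel_mul (hκ : 0 ≤ κ) (x : ℝ) {p : ℝ≥0∞}
    (hf : MemLp f p (dunklMeasure κ)) :
    MemLp (fun y : ℝ => dunklKernel κ (Complex.I * x) y * f y) p (dunklMeasure κ) := by
  refine hf.mono ?_ (Eventually.of_forall fun y => ?_)
  · exact ((continuous_dunklKernel_I_mul hκ).comp
      (f := fun y : ℝ => (x, y)) (by fun_prop)).aestronglyMeasurable.mul hf.aestronglyMeasurable
  · rw [norm_mul]
    exact mul_le_of_le_one_left (norm_nonneg _) (norm_dunklKernel_I_mul_le hκ x y)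

lemma isDunklTranslate_iff (hκ : 0 ≤ κ) (x : ℝ) (hf : MemLp f 2 (dunklMeasure κ))
    (hg : MemLp g 2 (dunklMeasure κ)) :
    IsDunklTranslate κ x f g ↔ dunklL2 hκ hg.toLp =ᵐ[dunklMeasure κ]
      fun y : ℝ => dunklKernel κ (Complex.I * x) y * dunklL2 hκ hf.toLp y := by
  constructor
  · rintro ⟨F, G, hF, hG, h⟩
    rw [isDunklTransformL2_iff hκ hf] at hF
    rw [isDunklTransformL2_iff hκ hg] at hG
    filter_upwards [hF, hG, h] with y h1 h2 h3
    rw [← h2, h3, h1]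
  · intro h
    exact ⟨_, _, (isDunklTransformL2_iff hκ hf).2 EventuallyEq.rfl,
      (isDunklTransformL2_iff hκ hg).2 EventuallyEq.rfl, h⟩

/-- The Dunkl translate exists in `L²`. -/
lemma isDunklTranslate_dunklTranslation (hκ : 0 ≤ κ) (x : ℝ) (hf : MemLp f 2 (dunklMeasure κ)) :
    IsDunklTranslate κ x f (dunklTranslation κ x f) := by
  have h : ∃ g, IsDunklTranslate κ x f g := by
    set G := ((Lp.memLp (dunklL2 hκ hf.toLp)).dunklKernel_mul hκ x).toLp with hG
    -- Inverting the transform on the multiplier applied to the transform of `f` gives the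
    -- translate.
    refine ⟨dunklL2 hκ (reflL2 κ G), (isDunklTranslate_iff hκ x hf (Lp.memLp _)).2 ?_⟩
    have hr : dunklL2 hκ (dunklL2 hκ (reflL2 κ G)) = G := by rw [dunklL2_dunklL2, reflL2_reflL2]
    rw [Lp.toLp_coeFn, hr]
    exact MemLp.coeFn_toLp _
  rw [dunklTranslation, dif_pos h]
  exact h.choose_spec

lemma memLp_dunklTranslation (hκ : 0 ≤ κ) (x : ℝ) (hf : MemLp f 2 (dunklMeasure κ)) :
    MemLp (dunklTranslation κ x f) 2 (dunklMeasure κ) := by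
  obtain ⟨F, G, hF, hG, h⟩ := isDunklTranslate_dunklTranslation hκ x hf
  exact hG.1

/-- The Dunkl translate of `f` is an `L²` limit of explicit integrals, for any approximation
of the transform of `f` by integrable functions. -/
lemma tendsto_eLpNorm_sub_dunklTranslation (hκ : 0 ≤ κ) (x : ℝ) (hF : IsDunklTransformL2 κ f F)
    {w : ℕ → ℝ → ℂ} (hw1 : ∀ k, Integrable (w k) (dunklMeasure κ))
    (hw2 : ∀ k, MemLp (w k) 2 (dunklMeasure κ))
    (hw : Tendsto (fun k => eLpNorm (w k - F) 2 (dunklMeasure κ)) atTop (𝓝 0)) :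
    Tendsto (fun k => eLpNorm ((fun y => dunklTransform κ
      (fun z : ℝ => dunklKernel κ (Complex.I * x) z * w k z) (-y)) - dunklTranslation κ x f) 2
      (dunklMeasure κ)) atTop (𝓝 0) := by
  have hf : MemLp f 2 (dunklMeasure κ) := hF.1
  have hFU := (isDunklTransformL2_iff hκ hf).1 hF
  have hg := memLp_dunklTranslation hκ x hf
  have ht := (isDunklTranslate_iff hκ x hf hg).1 (isDunklTranslate_dunklTranslation hκ x hf)
  have hE1 : ∀ k, Integrable (fun z : ℝ => dunklKernel κ (Complex.I * x) z * w k z)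
      (dunklMeasure κ) := fun k =>
    memLp_one_iff_integrable.1 ((memLp_one_iff_integrable.2 (hw1 k)).dunklKernel_mul hκ x)
  have hE2 := fun k => (hw2 k).dunklKernel_mul hκ x
  refine tendsto_of_tendsto_of_tendsto_of_le_of_le tendsto_const_nhds hw (fun _ => zero_le)
    fun k => ?_
  have e1 : eLpNorm ((fun y => dunklTransform κ
      (fun z : ℝ => dunklKernel κ (Complex.I * x) z * w k z) (-y)) - dunklTranslation κ x f) 2
      (dunklMeasure κ) = edist (reflL2 κ (dunklL2 hκ (hE2 k).toLp)) hg.toLp := by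
    rw [Lp.edist_def]
    refine eLpNorm_congr_ae (EventuallyEq.sub ?_ hg.coeFn_toLp.symm)
    filter_upwards [coeFn_reflL2 (dunklL2 hκ (hE2 k).toLp),
      ae_neg_of_ae (dunklTransform_ae_eq_dunklL2 hκ (hE1 k) (hE2 k))] with y h1 h2
    rw [h1, h2]
  -- By inversion the translate is also a reflected transform. Two isometries then reduce the
  -- distance to that between `E w_k` and `E F`, with `E` the kernel, at most that between `w_k` and
  -- `F` because the kernel is bounded by `1`.
  have e2 : hg.toLp = reflL2 κ (dunklL2 hκ (dunklL2 hκ hg.toLp)) := by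
    rw [dunklL2_dunklL2, reflL2_reflL2]
  rw [e1, e2, (reflL2 κ).isometry.edist_eq, (dunklL2 hκ).isometry.edist_eq, Lp.edist_def]
  refine eLpNorm_mono_ae ?_
  filter_upwards [(hE2 k).coeFn_toLp, ht, hFU] with y h1 h2 h3
  rw [Pi.sub_apply, Pi.sub_apply, h1, h2, h3, ← mul_sub, norm_mul]
  exact mul_le_of_le_one_left (norm_nonneg _) (norm_dunklKernel_I_mul_le hκ x y)

end

/-! ### The wave system for translates -/

/-- The part of the inverse transform of `E(i t, ·) w` that is even in both variables. -/
def waveEven (κ : ℝ) (w : ℝ → ℝ) (t y : ℝ) : ℝ :=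
  ∫ z, dunklCos κ (t * z) * dunklCos κ (y * z) * w z ∂dunklMeasure κ

/-- Minus the part of the inverse transform of `E(i t, ·) w` that is odd in both variables. -/
def waveOdd (κ : ℝ) (w : ℝ → ℝ) (t y : ℝ) : ℝ :=
  ∫ z, dunklSin κ (t * z) * dunklSin κ (y * z) * w z ∂dunklMeasure κ

/-- Minus the derivative of `waveEven` in the first variable. -/
def waveDeriv (κ : ℝ) (w : ℝ → ℝ) (t y : ℝ) : ℝ :=
  ∫ z, dunklSin κ (t * z) * dunklCos κ (y * z) * (z * w z) ∂dunklMeasure κ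

section Wave

variable {κ : ℝ} {w : ℝ → ℝ}

lemma abs_mul_mul_le {a b c : ℝ} (ha : |a| ≤ 1) (hb : |b| ≤ 1) : |a * b * c| ≤ |c| := by
  rw [abs_mul, abs_mul]
  exact mul_le_of_le_one_left (abs_nonneg _) (mul_le_one₀ ha (abs_nonneg _) hb)

lemma integrable_kernel_mul {a b : ℝ → ℝ} (ha : Continuous a) (hb : Continuous b)
    (ha1 : ∀ z, |a z| ≤ 1) (hb1 : ∀ z, |b z| ≤ 1) (hw : Integrable w (dunklMeasure κ)) (t y : ℝ) :
    Integrable (fun z => a (t * z) * b (y * z) * w z) (dunklMeasure κ) := by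
  refine hw.mono ?_ (Eventually.of_forall fun z => abs_mul_mul_le (ha1 _) (hb1 _))
  exact ((ha.comp (continuous_const.mul continuous_id)).mul
    (hb.comp (continuous_const.mul continuous_id))).aestronglyMeasurable.mul hw.aestronglyMeasurable

lemma continuous_integral_kernel_mul {a b : ℝ → ℝ} (ha : Continuous a) (hb : Continuous b)
    (ha1 : ∀ z, |a z| ≤ 1) (hb1 : ∀ z, |b z| ≤ 1) (hw : Integrable w (dunklMeasure κ)) :
    Continuous fun p : ℝ × ℝ => ∫ z, a (p.1 * z) * b (p.2 * z) * w z ∂dunklMeasure κ := by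
  refine continuous_of_dominated (bound := fun z => |w z|)
    (fun p => (integrable_kernel_mul ha hb ha1 hb1 hw p.1 p.2).aestronglyMeasurable)
    (fun p => Eventually.of_forall fun z => abs_mul_mul_le (ha1 _) (hb1 _)) hw.abs
    (Eventually.of_forall fun z => ?_)
  exact ((ha.comp (by fun_prop)).mul (hb.comp (by fun_prop))).mul continuous_const

lemma waveEven_comm (t y : ℝ) : waveEven κ w t y = waveEven κ w y t := by
  unfold waveEven
  congr 1 with z
  ring

lemma waveOdd_comm (t y : ℝ) : waveOdd κ w t y = waveOdd κ w y t := by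
  unfold waveOdd
  congr 1 with z
  ring

lemma waveOdd_zero_right (hκ : 0 ≤ κ) (t : ℝ) : waveOdd κ w t 0 = 0 := by
  simp [waveOdd, dunklSin_zero hκ]

lemma waveOdd_zero_left (hκ : 0 ≤ κ) (y : ℝ) : waveOdd κ w 0 y = 0 := by
  simp [waveOdd, dunklSin_zero hκ]

lemma continuous_waveEven (hκ : 0 ≤ κ) (hw : Integrable w (dunklMeasure κ)) :
    Continuous fun p : ℝ × ℝ => waveEven κ w p.1 p.2 :=
  continuous_integral_kernel_mul (continuous_dunklCos hκ) (continuous_dunklCos hκ)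
    (abs_dunklCos_le_one hκ) (abs_dunklCos_le_one hκ) hw

lemma continuous_waveOdd (hκ : 0 ≤ κ) (hw : Integrable w (dunklMeasure κ)) :
    Continuous fun p : ℝ × ℝ => waveOdd κ w p.1 p.2 :=
  continuous_integral_kernel_mul (continuous_dunklSin hκ) (continuous_dunklSin hκ)
    (abs_dunklSin_le_one hκ) (abs_dunklSin_le_one hκ) hw

lemma continuous_waveDeriv (hκ : 0 ≤ κ) (hw : Integrable (fun z => z * w z) (dunklMeasure κ)) :
    Continuous fun p : ℝ × ℝ => waveDeriv κ w p.1 p.2 :=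
  continuous_integral_kernel_mul (continuous_dunklSin hκ) (continuous_dunklCos hκ)
    (abs_dunklSin_le_one hκ) (abs_dunklCos_le_one hκ) hw

lemma hasDerivAt_waveEven (hκ : 0 ≤ κ) (hw : Integrable w (dunklMeasure κ))
    (hw1 : Integrable (fun z => z * w z) (dunklMeasure κ)) (t y : ℝ) :
    HasDerivAt (fun t => waveEven κ w t y) (-waveDeriv κ w t y) t := by
  have cA := continuous_dunklCos hκ
  have cB := continuous_dunklSin hκ
  have bA := abs_dunklCos_le_one hκ
  have bB := abs_dunklSin_le_one hκ
  have h := hasDerivAt_integral_of_dominated_loc_of_deriv_le (μ := dunklMeasure κ)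
    (F := fun t z => dunklCos κ (t * z) * dunklCos κ (y * z) * w z)
    (F' := fun t z => -(dunklSin κ (t * z) * dunklCos κ (y * z) * (z * w z)))
    (bound := fun z => |z * w z|) (x₀ := t) (s := univ) univ_mem
    (Eventually.of_forall fun t =>
      (integrable_kernel_mul cA cA bA bA hw t y).aestronglyMeasurable)
    (integrable_kernel_mul cA cA bA bA hw t y)
    (integrable_kernel_mul cB cA bB bA hw1 t y).neg.aestronglyMeasurable
    (Eventually.of_forall fun z t _ => by
      rw [norm_neg]; exact abs_mul_mul_le (bB _) (bA _)) hw1.abs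
    (Eventually.of_forall fun z t _ => by
      have h := (((hasDerivAt_dunklCos hκ (t * z)).comp t
        ((hasDerivAt_id t).mul_const z)).mul_const (dunklCos κ (y * z))).mul_const (w z)
      refine h.congr_deriv ?_
      ring)
  rw [integral_neg] at h
  exact h.2

/-- With `P`, `Q`, `D` for `waveEven`, `waveOdd`, `waveDeriv`, this and `hasDerivAt_waveEven` give
`P_t = -D(t, y)` and `Q_t + (2κ / t) Q = D(y, t)`. Since `P` and `Q` are symmetric in `(t, y)`, also
`P_y = -D(y, t)` and `Q_y + (2κ / y) Q = D(t, y)`, which closes the system. -/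
lemma hasDerivAt_waveOdd (hκ : 0 ≤ κ) (hw : Integrable w (dunklMeasure κ))
    (hw1 : Integrable (fun z => z * w z) (dunklMeasure κ)) {t : ℝ} (ht : 0 < t) (y : ℝ) :
    HasDerivAt (fun t => waveOdd κ w t y) (waveDeriv κ w y t - 2 * κ / t * waveOdd κ w t y) t := by
  have cA := continuous_dunklCos hκ
  have cB := continuous_dunklSin hκ
  have bA := abs_dunklCos_le_one hκ
  have bB := abs_dunklSin_le_one hκ
  have i1 := fun t => integrable_kernel_mul cB cA bB bA hw1 y t
  have i2 := fun t => integrable_kernel_mul cB cB bB bB hw t y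
  have h := hasDerivAt_integral_of_dominated_loc_of_deriv_le (μ := dunklMeasure κ)
    (F := fun t z => dunklSin κ (t * z) * dunklSin κ (y * z) * w z)
    (F' := fun t z => dunklSin κ (y * z) * dunklCos κ (t * z) * (z * w z) -
      2 * κ / t * (dunklSin κ (t * z) * dunklSin κ (y * z) * w z))
    -- Staying above `t / 2` keeps the singular coefficient `2κ / x` bounded.
    (bound := fun z => |z * w z| + 2 * κ / (t / 2) * |w z|) (x₀ := t) (s := Ioi (t / 2))
    (Ioi_mem_nhds (by linarith))
    (Eventually.of_forall fun t => (i2 t).aestronglyMeasurable) (i2 t)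
    ((i1 t).sub ((i2 t).const_mul _)).aestronglyMeasurable
    (Eventually.of_forall fun z x hx => by
      have hx' : t / 2 < x := hx
      have hx0 : 0 < x := by linarith
      refine (norm_sub_le _ _).trans (add_le_add (abs_mul_mul_le (bB _) (bA _)) ?_)
      rw [norm_mul, Real.norm_of_nonneg (by positivity)]
      gcongr
      exact abs_mul_mul_le (bB _) (bB _))
    (hw1.abs.add (hw.abs.const_mul _))
    (Eventually.of_forall fun z x hx => by
      have hx' : t / 2 < x := hx
      have hx0 : 0 < x := by linarith
      rcases eq_or_ne z 0 with rfl | hz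
      · simpa [dunklSin_zero hκ] using hasDerivAt_const x (0 : ℝ)
      have h := (((hasDerivAt_dunklSin hκ (mul_ne_zero hx0.ne' hz)).comp x
        ((hasDerivAt_id x).mul_const z)).mul_const (dunklSin κ (y * z))).mul_const (w z)
      refine h.congr_deriv ?_
      field_simp)
  rw [integral_sub (i1 t) ((i2 t).const_mul _), integral_const_mul] at h
  exact h.2

end Wave

/-! ### The energy estimate -/

/-- The cutoff `(R - s)₊²`. -/
def cutoff (R s : ℝ) : ℝ := max (R - s) 0 ^ 2

/-- Squaring removes the corner: the derivative away from `0` extends continuously to `0`. This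
makes the cutoff differentiable everywhere. -/
lemma hasDerivAt_max_sq (x : ℝ) : HasDerivAt (fun x : ℝ => max x 0 ^ 2) (2 * max x 0) x := by
  have h : ∀ y : ℝ, y ≠ 0 → HasDerivAt (fun x : ℝ => max x 0 ^ 2) (2 * max y 0) y := by
    intro y hy
    rcases lt_or_gt_of_ne hy with hy | hy
    · rw [max_eq_right hy.le, mul_zero]
      refine (hasDerivAt_const y (0 : ℝ)).congr_of_eventuallyEq ?_
      filter_upwards [Iio_mem_nhds hy] with z hz
      rw [max_eq_right (le_of_lt hz)]
      norm_num
    · rw [max_eq_left hy.le]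
      have := hasDerivAt_pow 2 y
      simp only [Nat.cast_ofNat, Nat.add_one_sub_one, pow_one] at this
      refine this.congr_of_eventuallyEq ?_
      filter_upwards [Ioi_mem_nhds hy] with z hz
      rw [max_eq_left (le_of_lt hz)]
  rcases eq_or_ne x 0 with rfl | hx
  · exact hasDerivAt_of_hasDerivAt_of_ne (g := fun y => 2 * max y 0) h
      (by fun_prop) (by fun_prop)
  · exact h x hx

lemma hasDerivAt_cutoff (R s : ℝ) : HasDerivAt (cutoff R) (-(2 * max (R - s) 0)) s := by
  have h := (hasDerivAt_max_sq (R - s)).comp s ((hasDerivAt_id s).const_sub R)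
  refine h.congr_deriv ?_
  ring

lemma continuous_cutoff (R : ℝ) : Continuous (cutoff R) := by unfold cutoff; fun_prop

lemma cutoff_nonneg (R s : ℝ) : 0 ≤ cutoff R s := sq_nonneg _

/-- The localized energy of a solution of `T_t u = T_y u`. -/
def waveEnergy (κ : ℝ) (w : ℝ → ℝ) (R t : ℝ) : ℝ :=
  ∫ y in (0 : ℝ)..R, cutoff R (y + t) *
    ((waveEven κ w t y - 1) ^ 2 + waveOdd κ w t y ^ 2) * y ^ (2 * κ)

section Energy

variable {κ : ℝ} {w : ℝ → ℝ}

lemma continuous_rpow_two_mul (hκ : 0 ≤ κ) : Continuous fun y : ℝ => y ^ (2 * κ) :=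
  continuous_id.rpow_const fun _ => Or.inr (by positivity)

lemma continuous_waveEnergy (hκ : 0 ≤ κ) (hw : Integrable w (dunklMeasure κ)) (R : ℝ) :
    Continuous (waveEnergy κ w R) := by
  refine intervalIntegral.continuous_parametric_intervalIntegral_of_continuous' ?_ 0 R
  have h1 := continuous_waveEven hκ hw
  have h2 := continuous_waveOdd hκ hw
  have h3 := (continuous_rpow_two_mul hκ).comp (continuous_snd (X := ℝ) (Y := ℝ))
  have h4 := (continuous_cutoff R).comp (continuous_snd.add (continuous_fst (X := ℝ) (Y := ℝ)))
  exact (h4.mul (((h1.sub continuous_const).pow 2).add (h2.pow 2))).mul h3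

/-- The integrated flux of the energy vanishes. -/
lemma integral_waveFlux (hκ : 0 ≤ κ) (hw : Integrable w (dunklMeasure κ))
    (hw1 : Integrable (fun z => z * w z) (dunklMeasure κ)) {R t : ℝ} (hR : 0 ≤ R) (ht : 0 < t) :
    ∫ y in (0 : ℝ)..R, (-(2 * max (R - (y + t)) 0) * ((waveEven κ w t y - 1) * waveOdd κ w t y) +
      cutoff R (y + t) * (-waveDeriv κ w y t * waveOdd κ w t y +
        (waveEven κ w t y - 1) * waveDeriv κ w t y)) * y ^ (2 * κ) = 0 := by
  have cP : Continuous fun y => waveEven κ w t y :=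
    (continuous_waveEven hκ hw).comp (f := fun y : ℝ => (t, y)) (by fun_prop)
  have cQ : Continuous fun y => waveOdd κ w t y :=
    (continuous_waveOdd hκ hw).comp (f := fun y : ℝ => (t, y)) (by fun_prop)
  have cD : Continuous fun y => waveDeriv κ w t y :=
    (continuous_waveDeriv hκ hw1).comp (f := fun y : ℝ => (t, y)) (by fun_prop)
  have cD' : Continuous fun y => waveDeriv κ w y t :=
    (continuous_waveDeriv hκ hw1).comp (f := fun y : ℝ => (y, t)) (by fun_prop)
  have cw := continuous_rpow_two_mul hκ
  have cc : Continuous fun y => cutoff R (y + t) := (continuous_cutoff R).comp (by fun_prop)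
  have cc' : Continuous fun y => -(2 * max (R - (y + t)) 0) := by fun_prop
  -- The integrand is the `y`-derivative of `cutoff * (P - 1) * Q * y ^ (2κ)`. The boundary terms
  -- vanish, at `R` by the cutoff and at `0` because `Q` is odd in `y`.
  rw [intervalIntegral.integral_eq_sub_of_hasDerivAt_of_le hR
    (f := fun y => cutoff R (y + t) * ((waveEven κ w t y - 1) * waveOdd κ w t y) * y ^ (2 * κ))]
  · have h1 : cutoff R (R + t) = 0 := by
      rw [cutoff, max_eq_right (by linarith)]; norm_num
    rw [h1, waveOdd_zero_right hκ]
    ring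
  · exact ((cc.mul ((cP.sub continuous_const).mul cQ)).mul cw).continuousOn
  · intro y hy
    have hy0 : 0 < y := hy.1
    have d1 := (hasDerivAt_cutoff R (y + t)).comp y ((hasDerivAt_id y).add_const t)
    have d2 : HasDerivAt (fun y => waveEven κ w t y) (-waveDeriv κ w y t) y := by
      simpa only [waveEven_comm] using hasDerivAt_waveEven hκ hw hw1 y t
    have d3 : HasDerivAt (fun y => waveOdd κ w t y)
        (waveDeriv κ w t y - 2 * κ / y * waveOdd κ w t y) y := by
      have := hasDerivAt_waveOdd hκ hw hw1 hy0 t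
      rw [waveOdd_comm y t] at this
      exact this.congr_of_eventuallyEq (Eventually.of_forall fun y => waveOdd_comm t y)
    have d4 := Real.hasDerivAt_rpow_const (x := y) (p := 2 * κ) (Or.inl hy0.ne')
    refine ((d1.mul ((d2.sub_const 1).mul d3)).mul d4).congr_deriv ?_
    simp only [Function.comp, id, Pi.mul_apply]
    rw [Real.rpow_sub_one hy0.ne']
    field_simp
    ring
  · exact (((cc'.mul ((cP.sub continuous_const).mul cQ)).add (cc.mul ((cD'.neg.mul cQ).add
      ((cP.sub continuous_const).mul cD)))).mul cw).intervalIntegrable _ _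

/-- Up to a total `y`-derivative, whose integral is zero, two losses remain: one from the cutoff,
which recedes at the propagation speed `1`, and one from the damping `2κ Q / t`. -/
lemma exists_hasDerivAt_waveEnergy_nonpos (hκ : 0 ≤ κ) (hw : Integrable w (dunklMeasure κ))
    (hw1 : Integrable (fun z => z * w z) (dunklMeasure κ)) {R t : ℝ} (hR : 0 ≤ R) (ht : 0 < t) :
    ∃ e ≤ 0, HasDerivAt (waveEnergy κ w R) e t := by
  have cP := continuous_waveEven hκ hw
  have cQ := continuous_waveOdd hκ hw
  have cD := continuous_waveDeriv hκ hw1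
  have cD' := cD.comp (continuous_swap (X := ℝ) (Y := ℝ))
  have cw := (continuous_rpow_two_mul hκ).comp (continuous_snd (X := ℝ) (Y := ℝ))
  have cc := (continuous_cutoff R).comp (continuous_snd.add (continuous_fst (X := ℝ) (Y := ℝ)))
  have cc' : Continuous fun p : ℝ × ℝ => -(2 * max (R - (p.2 + p.1)) 0) := by fun_prop
  set H : ℝ → ℝ → ℝ := fun t y => cutoff R (y + t) *
    ((waveEven κ w t y - 1) ^ 2 + waveOdd κ w t y ^ 2) * y ^ (2 * κ) with hH
  set H' : ℝ → ℝ → ℝ := fun t y => (-(2 * max (R - (y + t)) 0) *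
      ((waveEven κ w t y - 1) ^ 2 + waveOdd κ w t y ^ 2) +
    cutoff R (y + t) * (2 * (waveEven κ w t y - 1) * -waveDeriv κ w t y +
      2 * waveOdd κ w t y * (waveDeriv κ w y t - 2 * κ / t * waveOdd κ w t y))) *
        y ^ (2 * κ) with hH'
  have cH : Continuous (Function.uncurry H) :=
    (cc.mul (((cP.sub continuous_const).pow 2).add (cQ.pow 2))).mul cw
  have cH' : ContinuousOn (Function.uncurry H') (Ioi 0 ×ˢ univ) := by
    have c1 : ContinuousOn (fun p : ℝ × ℝ => 2 * κ / p.1) (Ioi 0 ×ˢ univ) :=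
      continuousOn_const.div continuousOn_fst fun p hp => (ne_of_gt hp.1)
    exact (((cc'.mul (((cP.sub continuous_const).pow 2).add (cQ.pow 2))).continuousOn).add
      (cc.continuousOn.mul (((continuous_const.mul (cP.sub continuous_const)).mul
        cD.neg).continuousOn.add ((continuous_const.mul cQ).continuousOn.mul
          (cD'.continuousOn.sub (c1.mul cQ.continuousOn)))))).mul cw.continuousOn
  have cHt : ∀ t, 0 < t → Continuous (H' t) := fun t ht =>
    cH'.comp_continuous (f := fun y : ℝ => (t, y)) (by fun_prop) fun y => ⟨ht, trivial⟩
  -- Compactness of `[t / 2, 2t] × [0, R]`, which avoids the singularity at time zero, gives the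
  -- constant dominating the time derivative.
  obtain ⟨C, hC⟩ := (isCompact_Icc (a := t / 2) (b := 2 * t)).prod
    (isCompact_Icc (a := 0) (b := R)) |>.exists_bound_of_continuousOn
    (cH'.mono fun p hp => ⟨lt_of_lt_of_le (by linarith) hp.1.1, trivial⟩)
  have hd := intervalIntegral.hasDerivAt_integral_of_dominated_loc_of_deriv_le
    (μ := volume) (a := 0) (b := R) (F := H) (F' := H') (bound := fun _ => C) (x₀ := t)
    (s := Ioo (t / 2) (2 * t)) (Ioo_mem_nhds (by linarith) (by linarith))
    (Eventually.of_forall fun t =>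
      (cH.comp (f := fun y : ℝ => (t, y)) (by fun_prop)).aestronglyMeasurable)
    ((cH.comp (f := fun y : ℝ => (t, y)) (by fun_prop)).intervalIntegrable _ _)
    (cHt t ht).aestronglyMeasurable
    (Eventually.of_forall fun y hy x hx => by
      rw [uIoc_of_le hR] at hy
      exact hC (x, y) ⟨⟨hx.1.le, hx.2.le⟩, ⟨hy.1.le, hy.2⟩⟩)
    intervalIntegrable_const
    (Eventually.of_forall fun y hy x hx => by
      have hx0 : 0 < x := by have := hx.1; linarith
      have d1 := (hasDerivAt_cutoff R (y + x)).comp x ((hasDerivAt_id x).const_add y)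
      have d2 := hasDerivAt_waveEven hκ hw hw1 x y
      have d3 := hasDerivAt_waveOdd hκ hw hw1 hx0 y
      refine ((d1.mul (((d2.sub_const 1).pow 2).add (d3.pow 2))).mul_const
        (y ^ (2 * κ))).congr_deriv ?_
      simp only [Function.comp, Pi.pow_apply, Pi.add_apply, hH']
      push_cast
      ring)
  refine ⟨_, ?_, hd.2⟩
  have hflux := integral_waveFlux hκ hw hw1 hR ht
  set G : ℝ → ℝ := fun y =>
    (-(2 * max (R - (y + t)) 0) * ((waveEven κ w t y - 1) * waveOdd κ w t y) +
      cutoff R (y + t) * (-waveDeriv κ w y t * waveOdd κ w t y +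
        (waveEven κ w t y - 1) * waveDeriv κ w t y)) * y ^ (2 * κ) with hG
  have cG : Continuous G := by
    have e : ∀ {f : ℝ × ℝ → ℝ}, Continuous f → Continuous fun y => f (t, y) := fun hf =>
      hf.comp (by fun_prop)
    exact ((((e cc').mul (((e cP).sub continuous_const).mul (e cQ))).add ((e cc).mul
      (((e cD').neg.mul (e cQ)).add (((e cP).sub continuous_const).mul (e cD))))).mul (e cw))
  calc ∫ y in (0 : ℝ)..R, H' t y ≤ ∫ y in (0 : ℝ)..R, (-2) * G y := by
        refine intervalIntegral.integral_mono_on hR ((cHt t ht).intervalIntegrable _ _)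
          ((continuous_const.mul cG).intervalIntegrable _ _) fun y hy => ?_
        have h1 : 0 ≤ y ^ (2 * κ) := Real.rpow_nonneg hy.1 _
        have h2 : 0 ≤ max (R - (y + t)) 0 := le_max_right _ _
        have h3 := cutoff_nonneg R (y + t)
        -- Unit speed of the cutoff turns the cross term of the flux into the perfect square `(P - 1
        -- + Q)²`; the damping term has a sign because `κ ≥ 0`.
        have h4 : (-2) * G y - H' t y = (2 * max (R - (y + t)) 0 *
            (waveEven κ w t y - 1 + waveOdd κ w t y) ^ 2 +
            4 * κ / t * cutoff R (y + t) * waveOdd κ w t y ^ 2) * y ^ (2 * κ) := by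
          simp only [hG, hH']
          field_simp
          ring
        have h5 : 0 ≤ (-2) * G y - H' t y := by
          rw [h4]
          positivity
        linarith
    _ = 0 := by rw [intervalIntegral.integral_const_mul, hflux, mul_zero]

/-- Finite speed of propagation. -/
lemma waveEnergy_le_waveEnergy_zero (hκ : 0 ≤ κ) (hw : Integrable w (dunklMeasure κ))
    (hw1 : Integrable (fun z => z * w z) (dunklMeasure κ)) {R t : ℝ} (hR : 0 ≤ R) (ht : 0 ≤ t) :
    waveEnergy κ w R t ≤ waveEnergy κ w R 0 := by
  have h := fun (t : ℝ) (ht : 0 < t) => exists_hasDerivAt_waveEnergy_nonpos hκ hw hw1 hR ht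
  -- The derivative is controlled only for positive times; continuity of the energy includes the
  -- initial time.
  refine antitoneOn_of_deriv_nonpos (convex_Ici 0) (continuous_waveEnergy hκ hw R).continuousOn
    ?_ ?_ (mem_Ici.2 le_rfl) ht ht
  · intro x hx
    rw [interior_Ici] at hx
    obtain ⟨e, -, he⟩ := h x hx
    exact he.differentiableAt.differentiableWithinAt
  · intro x hx
    rw [interior_Ici] at hx
    obtain ⟨e, he0, he⟩ := h x hx
    rwa [he.deriv]

end Energy

/-! ### Regularized translates of the indicator of a ball -/

section

variable {κ : ℝ} {w : ℝ → ℝ}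

lemma waveEven_neg_left (t y : ℝ) : waveEven κ w (-t) y = waveEven κ w t y := by
  simp [waveEven, dunklCos_neg]

lemma waveOdd_neg_left (t y : ℝ) : waveOdd κ w (-t) y = -waveOdd κ w t y := by
  simp [waveOdd, dunklSin_neg, integral_neg]

lemma waveEven_abs_left (t y : ℝ) : waveEven κ w |t| y = waveEven κ w t y := by
  rcases abs_choice t with h | h <;> rw [h]
  exact waveEven_neg_left t y

lemma waveOdd_abs_left_sq (t y : ℝ) : waveOdd κ w |t| y ^ 2 = waveOdd κ w t y ^ 2 := by
  rcases abs_choice t with h | h <;> rw [h]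
  rw [waveOdd_neg_left, neg_sq]

lemma integral_eq_zero_of_odd {f : ℝ → ℝ} (hf : ∀ y, f (-y) = -f y) :
    ∫ y, f y ∂dunklMeasure κ = 0 := by
  have h := integral_dunklMeasure_comp_neg κ f
  simp only [hf, integral_neg] at h
  linarith

/-- Expand the product of the two kernels. As `w` is even, the mixed products of `dunklCos` and
`dunklSin` are odd in `z` and integrate to zero, leaving a real wave. -/
lemma dunklTransform_dunklKernel_mul (hκ : 0 ≤ κ) (hw : Integrable w (dunklMeasure κ))
    (he : ∀ z, w (-z) = w z) (x y : ℝ) :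
    dunklTransform κ (fun z : ℝ => dunklKernel κ (Complex.I * x) z * (w z : ℂ)) (-y) =
      ((waveEven κ (fun z => mehtaConst κ * w z) x y -
        waveOdd κ (fun z => mehtaConst κ * w z) x y : ℝ) : ℂ) := by
  have cA := continuous_dunklCos hκ
  have cB := continuous_dunklSin hκ
  have bA := abs_dunklCos_le_one hκ
  have bB := abs_dunklSin_le_one hκ
  have i1 := integrable_kernel_mul cA cA bA bA hw x y
  have i2 := integrable_kernel_mul cB cB bB bB hw x y
  have i3 := integrable_kernel_mul cA cB bA bB hw x y
  have i4 := integrable_kernel_mul cB cA bB bA hw x y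
  have z3 : ∫ z, dunklCos κ (x * z) * dunklSin κ (y * z) * w z ∂dunklMeasure κ = 0 :=
    integral_eq_zero_of_odd fun z => by simp [dunklCos_neg, dunklSin_neg, he]
  have z4 : ∫ z, dunklSin κ (x * z) * dunklCos κ (y * z) * w z ∂dunklMeasure κ = 0 :=
    integral_eq_zero_of_odd fun z => by simp [dunklCos_neg, dunklSin_neg, he]
  have e : ∀ z : ℝ, dunklKernel κ (-Complex.I * (-y : ℝ)) z *
      (dunklKernel κ (Complex.I * x) z * (w z : ℂ)) =
      ((dunklCos κ (x * z) * dunklCos κ (y * z) * w z -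
        dunklSin κ (x * z) * dunklSin κ (y * z) * w z : ℝ) : ℂ) +
      ((dunklCos κ (x * z) * dunklSin κ (y * z) * w z +
        dunklSin κ (x * z) * dunklCos κ (y * z) * w z : ℝ) : ℂ) * Complex.I := by
    intro z
    rw [dunklKernel_neg_I_mul_eq, neg_neg, dunklKernel_I_mul, dunklKernel_I_mul]
    push_cast
    linear_combination (dunklSin κ (x * z) * dunklSin κ (y * z) * w z : ℂ) * Complex.I_sq
  unfold dunklTransform
  simp_rw [e]
  rw [integral_add (i1.sub i2).ofReal ((i3.add i4).ofReal.mul_const _), integral_mul_const,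
    integral_complex_ofReal, integral_complex_ofReal, integral_add i3 i4, z3, z4,
    integral_sub i1 i2]
  have e1 : waveEven κ (fun z => mehtaConst κ * w z) x y = mehtaConst κ * waveEven κ w x y := by
    unfold waveEven
    rw [← integral_const_mul]
    congr 1 with z
    ring
  have e2 : waveOdd κ (fun z => mehtaConst κ * w z) x y = mehtaConst κ * waveOdd κ w x y := by
    unfold waveOdd
    rw [← integral_const_mul]
    congr 1 with z
    ring
  rw [e1, e2]
  unfold waveEven waveOdd
  push_cast
  ring

lemma dunklTranslation_zero (hκ : 0 ≤ κ) {f : ℝ → ℂ} (hf : MemLp f 2 (dunklMeasure κ)) :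
    dunklTranslation κ 0 f =ᵐ[dunklMeasure κ] f := by
  have hg := memLp_dunklTranslation hκ 0 hf
  have ht := (isDunklTranslate_iff hκ 0 hf hg).1 (isDunklTranslate_dunklTranslation hκ 0 hf)
  have h1 : dunklL2 hκ hg.toLp = dunklL2 hκ hf.toLp := by
    ext1
    filter_upwards [ht] with y hy
    rw [hy, dunklKernel_I_mul, zero_mul, dunklCos_zero hκ, dunklSin_zero hκ]
    simp
  exact (MemLp.toLp_eq_toLp_iff hg hf).1 ((dunklL2 hκ).injective h1)

/-- The indicator function of the ball of radius `ρ`. -/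
def ballIndicator (ρ : ℝ) : ℝ → ℂ := (Metric.ball (0 : ℝ) ρ).indicator 1

lemma memLp_ballIndicator (hκ : 0 ≤ κ) (ρ : ℝ) (p : ℝ≥0∞) :
    MemLp (ballIndicator ρ) p (dunklMeasure κ) := by
  have := isLocallyFiniteMeasure_dunklMeasure hκ
  refine memLp_indicator_const p measurableSet_ball 1 (Or.inr ?_)
  exact (measure_ball_lt_top).ne

/-- The Dunkl transform of the indicator function of a ball. -/
def ballTransform (κ ρ x : ℝ) : ℝ := (dunklTransform κ (ballIndicator ρ) x).re

lemma ballIndicator_neg (ρ y : ℝ) : ballIndicator ρ (-y) = ballIndicator ρ y := by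
  simp [ballIndicator, indicator]

lemma ballIndicator_conj (ρ y : ℝ) : starRingEnd ℂ (ballIndicator ρ y) = ballIndicator ρ y := by
  by_cases h : y ∈ Metric.ball (0 : ℝ) ρ <;> simp [ballIndicator, h]

lemma dunklTransform_neg_of_even {f : ℝ → ℂ} (hf : ∀ y, f (-y) = f y) (x : ℝ) :
    dunklTransform κ f (-x) = dunklTransform κ f x := by
  unfold dunklTransform
  rw [← integral_dunklMeasure_comp_neg]
  congr 2 with y
  rw [hf, dunklKernel_neg_I_mul, dunklKernel_neg_I_mul, neg_mul_neg]

lemma dunklTransform_conj {f : ℝ → ℂ} (hf : ∀ y, starRingEnd ℂ (f y) = f y) (x : ℝ) :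
    starRingEnd ℂ (dunklTransform κ f x) = dunklTransform κ f (-x) := by
  unfold dunklTransform
  rw [map_mul, Complex.conj_ofReal, ← integral_conj]
  congr 2 with y
  rw [map_mul, hf, dunklKernel_neg_I_mul, dunklKernel_neg_I_mul]
  simp [dunklCos_neg, dunklSin_neg]

lemma dunklTransform_ballIndicator (ρ x : ℝ) :
    dunklTransform κ (ballIndicator ρ) x = ballTransform κ ρ x := by
  refine (Complex.conj_eq_iff_re.1 ?_).symm
  rw [dunklTransform_conj (ballIndicator_conj ρ), dunklTransform_neg_of_even (ballIndicator_neg ρ)]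

lemma ballTransform_neg (ρ x : ℝ) : ballTransform κ ρ (-x) = ballTransform κ ρ x := by
  unfold ballTransform
  rw [dunklTransform_neg_of_even (ballIndicator_neg ρ)]

lemma continuous_ballTransform (hκ : 0 ≤ κ) (ρ : ℝ) : Continuous (ballTransform κ ρ) :=
  Complex.continuous_re.comp (continuous_dunklTransform hκ
    (memLp_one_iff_integrable.1 (memLp_ballIndicator hκ ρ 1)))

lemma exists_abs_ballTransform_le (hκ : 0 ≤ κ) (ρ : ℝ) : ∃ C, ∀ x, |ballTransform κ ρ x| ≤ C :=
  ⟨_, fun x => (Complex.abs_re_le_norm _).trans (norm_dunklTransform_le hκ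
    (memLp_one_iff_integrable.1 (memLp_ballIndicator hκ ρ 1)) x)⟩

/-- Gaussian regularizations of the transform of the indicator function of a ball. -/
def ballApprox (κ ρ : ℝ) (k : ℕ) (z : ℝ) : ℝ :=
  ballTransform κ ρ z * gauss (1 / ((k : ℝ) + 1)) z

lemma integrable_ballApprox (hκ : 0 ≤ κ) (ρ : ℝ) (k : ℕ) :
    Integrable (ballApprox κ ρ k) (dunklMeasure κ) := by
  obtain ⟨C, hC⟩ := exists_abs_ballTransform_le hκ ρ
  exact (integrable_mul_pow_mul_gauss hκ 0 (s := 1 / ((k : ℝ) + 1)) (by positivity)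
    (continuous_ballTransform hκ ρ) hC).congr (Eventually.of_forall fun z => by simp [ballApprox])

/-- The reason for the Gaussian factor: the wave system needs `w` and `z * w` integrable, while
`ballTransform` is only known to be bounded and in `L²`. -/
lemma integrable_mul_ballApprox (hκ : 0 ≤ κ) (ρ : ℝ) (k : ℕ) :
    Integrable (fun z => z * ballApprox κ ρ k z) (dunklMeasure κ) := by
  obtain ⟨C, hC⟩ := exists_abs_ballTransform_le hκ ρ
  have h := integrable_mul_pow_mul_gauss hκ 1 (s := 1 / ((k : ℝ) + 1))
    (by positivity) (continuous_ballTransform hκ ρ) hC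
  refine h.congr (Eventually.of_forall fun z => ?_)
  simp only [ballApprox]
  ring

lemma ballApprox_neg (ρ : ℝ) (k : ℕ) (z : ℝ) : ballApprox κ ρ k (-z) = ballApprox κ ρ k z := by
  rw [ballApprox, ballApprox, ballTransform_neg, gauss_neg]

lemma memLp_ballTransform (hκ : 0 ≤ κ) (ρ : ℝ) :
    MemLp (fun z => (ballTransform κ ρ z : ℂ)) 2 (dunklMeasure κ) := by
  have h := dunklTransform_ae_eq_dunklL2 hκ
    (memLp_one_iff_integrable.1 (memLp_ballIndicator hκ ρ 1)) (memLp_ballIndicator hκ ρ 2)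
  refine (Lp.memLp _).ae_eq (h.symm.trans (Eventually.of_forall fun z => ?_))
  exact dunklTransform_ballIndicator ρ z

lemma isDunklTransformL2_ballIndicator (hκ : 0 ≤ κ) (ρ : ℝ) :
    IsDunklTransformL2 κ (ballIndicator ρ) (fun z => (ballTransform κ ρ z : ℂ)) := by
  rw [isDunklTransformL2_iff hκ (memLp_ballIndicator hκ ρ 2)]
  have h := dunklTransform_ae_eq_dunklL2 hκ
    (memLp_one_iff_integrable.1 (memLp_ballIndicator hκ ρ 1)) (memLp_ballIndicator hκ ρ 2)
  exact EventuallyEq.trans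
    (Eventually.of_forall fun z => (dunklTransform_ballIndicator ρ z).symm) h

lemma memLp_ballApprox (hκ : 0 ≤ κ) (ρ : ℝ) (k : ℕ) :
    MemLp (fun z => (ballApprox κ ρ k z : ℂ)) 2 (dunklMeasure κ) := by
  refine (memLp_ballTransform hκ ρ).mono (Complex.continuous_ofReal.comp
    ((continuous_ballTransform hκ ρ).mul (continuous_gauss _))).aestronglyMeasurable
    (Eventually.of_forall fun z => ?_)
  rw [ballApprox, Complex.ofReal_mul, norm_mul]
  refine mul_le_of_le_one_right (norm_nonneg _) ?_
  rw [Complex.norm_real, Real.norm_of_nonneg (gauss_pos _ _).le]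
  exact gauss_le_one (by positivity) _

/-- Dominated convergence: the Gaussian factors lie between `0` and `1` and tend to `1` pointwise.
-/
lemma tendsto_ballApprox (hκ : 0 ≤ κ) (ρ : ℝ) :
    Tendsto (fun k => eLpNorm ((fun z => (ballApprox κ ρ k z : ℂ)) -
      fun z => (ballTransform κ ρ z : ℂ)) 2 (dunklMeasure κ)) atTop (𝓝 0) := by
  have hF := memLp_ballTransform hκ ρ
  have hlim : Tendsto (fun k : ℕ => ∫⁻ z, ‖((fun z => (ballApprox κ ρ k z : ℂ)) -
      fun z => (ballTransform κ ρ z : ℂ)) z‖ₑ ^ (2 : ℝ) ∂dunklMeasure κ) atTop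
      (𝓝 (∫⁻ z, 0 ∂dunklMeasure κ)) := by
    refine tendsto_lintegral_of_dominated_convergence'
      (fun z => ‖(ballTransform κ ρ z : ℂ)‖ₑ ^ (2 : ℝ)) (fun k => ?_) (fun k => ?_) ?_ ?_
    · exact (((memLp_ballApprox hκ ρ k).sub hF).aestronglyMeasurable.enorm).pow_const _
    · refine Eventually.of_forall fun z => ?_
      refine ENNReal.rpow_le_rpow ?_ (by norm_num)
      rw [enorm_le_iff_norm_le, Pi.sub_apply, ← Complex.ofReal_sub, Complex.norm_real,
        Complex.norm_real, ballApprox,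
        show ballTransform κ ρ z * gauss (1 / ((k : ℝ) + 1)) z - ballTransform κ ρ z =
          ballTransform κ ρ z * (gauss (1 / ((k : ℝ) + 1)) z - 1) by ring, norm_mul]
      refine mul_le_of_le_one_right (norm_nonneg _) ?_
      have h1 := gauss_pos (1 / ((k : ℝ) + 1)) z
      have h2 := gauss_le_one (s := 1 / ((k : ℝ) + 1)) (by positivity) z
      rw [Real.norm_eq_abs, abs_le]
      constructor <;> linarith
    · have h := lintegral_rpow_enorm_lt_top_of_eLpNorm_lt_top (by norm_num) (by norm_num) hF.2
      simpa using h.ne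
    · refine Eventually.of_forall fun z => ?_
      have h1 : Tendsto (fun k : ℕ => gauss (1 / ((k : ℝ) + 1)) z) atTop (𝓝 (gauss 0 z)) := by
        have hc : Continuous fun s => gauss s z := by unfold gauss; fun_prop
        exact (hc.tendsto 0).comp tendsto_one_div_add_atTop_nhds_zero_nat
      have h2 : Tendsto (fun k : ℕ => (ballApprox κ ρ k z : ℂ) - (ballTransform κ ρ z : ℂ)) atTop
          (𝓝 0) := by
        have h3 := (Complex.continuous_ofReal.tendsto _).comp
          (h1.const_mul (ballTransform κ ρ z))
        have h4 := h3.sub_const (ballTransform κ ρ z : ℂ)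
        simpa [gauss, ballApprox, Function.comp_def] using h4
      have h5 := (continuous_enorm.tendsto (0 : ℂ)).comp h2
      have h6 := ((ENNReal.continuous_rpow_const (y := 2)).tendsto _).comp h5
      simpa [Function.comp_def] using h6
  simp only [lintegral_zero] at hlim
  have h := ((ENNReal.continuous_rpow_const (y := 1 / 2)).tendsto _).comp hlim
  simp only [eLpNorm_eq_lintegral_rpow_enorm_toReal (p := 2) two_ne_zero ENNReal.ofNat_ne_top,
    ENNReal.toReal_ofNat]
  simpa [Function.comp_def] using h

/-- The regularized translates of the indicator function of a ball. -/
def ballWave (κ ρ : ℝ) (k : ℕ) (x y : ℝ) : ℝ :=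
  waveEven κ (fun z => mehtaConst κ * ballApprox κ ρ k z) x y -
    waveOdd κ (fun z => mehtaConst κ * ballApprox κ ρ k z) x y

lemma tendsto_ballWave (hκ : 0 ≤ κ) (ρ x : ℝ) :
    Tendsto (fun k => eLpNorm ((fun y => (ballWave κ ρ k x y : ℂ)) -
      dunklTranslation κ x (ballIndicator ρ)) 2 (dunklMeasure κ)) atTop (𝓝 0) := by
  have h := tendsto_eLpNorm_sub_dunklTranslation hκ x (isDunklTransformL2_ballIndicator hκ ρ)
    (w := fun k z => (ballApprox κ ρ k z : ℂ)) (fun k => (integrable_ballApprox hκ ρ k).ofReal)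
    (memLp_ballApprox hκ ρ) (tendsto_ballApprox hκ ρ)
  simp only [dunklTransform_dunklKernel_mul hκ (integrable_ballApprox hκ ρ _)
    (ballApprox_neg ρ _)] at h
  exact h

end

/-! ### Translates equal `1` inside the cone -/

section

variable {κ : ℝ}

lemma setIntegral_dunklMeasure {s : Set ℝ} (hs : MeasurableSet s) (f : ℝ → ℝ) :
    ∫ y in s, f y ∂dunklMeasure κ = ∫ y in s, |y| ^ (2 * κ) * f y := by
  rw [← integral_indicator hs, ← integral_indicator hs, integral_dunklMeasure]
  congr 1 with y
  by_cases h : y ∈ s <;> simp [h]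

lemma setIntegral_Icc_of_even (hκ : 0 ≤ κ) {f : ℝ → ℝ} (hf : Continuous f)
    (he : ∀ y, f (-y) = f y) {r : ℝ} (hr : 0 ≤ r) :
    ∫ y in Icc (-r) r, f y ∂dunklMeasure κ = 2 * ∫ y in (0 : ℝ)..r, f y * y ^ (2 * κ) := by
  have hc : Continuous fun y : ℝ => |y| ^ (2 * κ) * f y := (continuous_weight hκ).mul hf
  rw [setIntegral_dunklMeasure measurableSet_Icc, integral_Icc_eq_integral_Ioc,
    ← intervalIntegral.integral_of_le (by linarith),
    ← intervalIntegral.integral_add_adjacent_intervals (b := 0)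
      (hc.intervalIntegrable _ _) (hc.intervalIntegrable _ _)]
  have h1 : ∫ y in (-r)..0, |y| ^ (2 * κ) * f y = ∫ y in (0 : ℝ)..r, |y| ^ (2 * κ) * f y := by
    have := intervalIntegral.integral_comp_neg (a := 0) (b := r) fun y : ℝ => |y| ^ (2 * κ) * f y
    simpa [he] using this.symm
  have h2 : ∫ y in (0 : ℝ)..r, |y| ^ (2 * κ) * f y = ∫ y in (0 : ℝ)..r, f y * y ^ (2 * κ) := by
    refine intervalIntegral.integral_congr fun y hy => ?_
    rw [uIcc_of_le hr] at hy
    rw [abs_of_nonneg hy.1, mul_comm]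
  rw [h1, h2]
  ring

lemma eLpNorm_two_eq_ofReal_sqrt {ν : Measure ℝ} {f : ℝ → ℂ} (hf : MemLp f 2 ν) :
    eLpNorm f 2 ν = ENNReal.ofReal (√(∫ y, ‖f y‖ ^ 2 ∂ν)) := by
  rw [hf.eLpNorm_eq_integral_rpow_norm two_ne_zero ENNReal.ofNat_ne_top, Real.sqrt_eq_rpow]
  simp

section Local

variable {w : ℝ → ℝ}

/-- The energy at time zero is controlled by the distance of the initial value to `1`. -/
lemma waveEnergy_zero_le (hκ : 0 ≤ κ) (hw : Integrable w (dunklMeasure κ)) {R : ℝ} (hR : 0 ≤ R) :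
    waveEnergy κ w R 0 ≤
      R ^ 2 * ∫ y in Icc (-R) R, (waveEven κ w 0 y - 1) ^ 2 ∂dunklMeasure κ := by
  have cP : Continuous fun y => waveEven κ w 0 y :=
    (continuous_waveEven hκ hw).comp (f := fun y : ℝ => (0, y)) (by fun_prop)
  have cw := continuous_rpow_two_mul hκ
  have c1 : Continuous fun y => (waveEven κ w 0 y - 1) ^ 2 := (cP.sub continuous_const).pow 2
  have c2 : Continuous fun y => cutoff R (y + 0) := (continuous_cutoff R).comp (by fun_prop)
  rw [setIntegral_Icc_of_even hκ c1
    (fun y => by rw [waveEven_comm, waveEven_neg_left, waveEven_comm]) hR]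
  have h0 : 0 ≤ ∫ y in (0 : ℝ)..R, (waveEven κ w 0 y - 1) ^ 2 * y ^ (2 * κ) :=
    intervalIntegral.integral_nonneg hR fun y hy =>
      mul_nonneg (sq_nonneg _) (Real.rpow_nonneg hy.1 _)
  have h1 : waveEnergy κ w R 0 ≤
      ∫ y in (0 : ℝ)..R, R ^ 2 * ((waveEven κ w 0 y - 1) ^ 2 * y ^ (2 * κ)) := by
    unfold waveEnergy
    simp only [waveOdd_zero_left hκ, ne_eq, OfNat.ofNat_ne_zero, not_false_eq_true, zero_pow,
      add_zero (_ ^ 2)]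
    refine intervalIntegral.integral_mono_on hR ((c2.mul c1).mul cw |>.intervalIntegrable _ _)
      ((continuous_const.mul (c1.mul cw)).intervalIntegrable _ _) fun y hy => ?_
    rw [mul_assoc]
    refine mul_le_mul_of_nonneg_right ?_ (mul_nonneg (sq_nonneg _) (Real.rpow_nonneg hy.1 _))
    unfold cutoff
    have h2 := hy.1
    have h3 := hy.2
    rw [add_zero, max_eq_left (by linarith)]
    nlinarith
  rw [intervalIntegral.integral_const_mul] at h1
  nlinarith [sq_nonneg R]

/-- The energy controls the distance of the wave to `1`. -/
lemma setIntegral_sub_one_sq_le (hκ : 0 ≤ κ) (hw : Integrable w (dunklMeasure κ)) {R r δ : ℝ}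
    (x : ℝ) (hr : 0 ≤ r) (hδ : 0 < δ) (hR : r + |x| + δ ≤ R) :
    ∫ y in Icc (-r) r, (waveEven κ w x y - waveOdd κ w x y - 1) ^ 2 ∂dunklMeasure κ ≤
      4 / δ ^ 2 * waveEnergy κ w R |x| := by
  have := isLocallyFiniteMeasure_dunklMeasure hκ
  have hx := abs_nonneg x
  have cP : Continuous fun y => waveEven κ w x y :=
    (continuous_waveEven hκ hw).comp (f := fun y : ℝ => (x, y)) (by fun_prop)
  have cQ : Continuous fun y => waveOdd κ w x y :=
    (continuous_waveOdd hκ hw).comp (f := fun y : ℝ => (x, y)) (by fun_prop)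
  have cw := continuous_rpow_two_mul hκ
  have cc : Continuous fun y => cutoff R (y + |x|) := (continuous_cutoff R).comp (by fun_prop)
  set Φ : ℝ → ℝ := fun y => (waveEven κ w x y - 1) ^ 2 + waveOdd κ w x y ^ 2 with hΦ
  have cΦ : Continuous Φ := ((cP.sub continuous_const).pow 2).add (cQ.pow 2)
  have eΦ : ∀ y, Φ (-y) = Φ y := fun y => by
    simp only [hΦ, waveEven_comm x, waveOdd_comm x, waveEven_neg_left, waveOdd_neg_left, neg_sq]
  have hΦ0 : ∀ y, 0 ≤ Φ y := fun y => by positivity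
  -- This is `(a - b)² ≤ 2 (a² + b²)`. The factor `2`, together with the `2` from folding the
  -- interval onto the half-line, gives the constant `4`.
  have h1 : ∫ y in Icc (-r) r, (waveEven κ w x y - waveOdd κ w x y - 1) ^ 2 ∂dunklMeasure κ ≤
      ∫ y in Icc (-r) r, 2 * Φ y ∂dunklMeasure κ := by
    refine setIntegral_mono ((((cP.sub cQ).sub continuous_const).pow 2).continuousOn
      |>.integrableOn_compact isCompact_Icc) ((continuous_const.mul cΦ).continuousOn
      |>.integrableOn_compact isCompact_Icc) fun y => ?_
    simp only [hΦ]
    nlinarith [sq_nonneg (waveEven κ w x y - 1 + waveOdd κ w x y)]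
  rw [integral_const_mul, setIntegral_Icc_of_even hκ cΦ eΦ hr] at h1
  have h2 : waveEnergy κ w R |x| =
      ∫ y in (0 : ℝ)..R, cutoff R (y + |x|) * Φ y * y ^ (2 * κ) := by
    simp only [waveEnergy, waveEven_abs_left, waveOdd_abs_left_sq, hΦ]
  have h3 : ∫ y in (0 : ℝ)..r, δ ^ 2 * (Φ y * y ^ (2 * κ)) ≤
      ∫ y in (0 : ℝ)..r, cutoff R (y + |x|) * Φ y * y ^ (2 * κ) := by
    refine intervalIntegral.integral_mono_on hr
      ((continuous_const.mul (cΦ.mul cw)).intervalIntegrable _ _)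
      (((cc.mul cΦ).mul cw).intervalIntegrable _ _) fun y hy => ?_
    rw [mul_assoc (cutoff _ _)]
    -- For `y ≤ r` the margin gives `R - (y + |x|) ≥ δ`, so the cutoff is at least `δ²`.
    refine mul_le_mul_of_nonneg_right ?_ (mul_nonneg (hΦ0 y) (Real.rpow_nonneg hy.1 _))
    have h4 := hy.2
    exact pow_le_pow_left₀ hδ.le (le_max_of_le_left (by linarith)) 2
  have h5 : ∫ y in (0 : ℝ)..r, cutoff R (y + |x|) * Φ y * y ^ (2 * κ) ≤ waveEnergy κ w R |x| := by
    rw [h2]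
    refine intervalIntegral.integral_mono_interval le_rfl hr (by linarith) ?_
      (((cc.mul cΦ).mul cw).intervalIntegrable _ _)
    filter_upwards [ae_restrict_mem measurableSet_Ioc] with y hy
    exact mul_nonneg (mul_nonneg (cutoff_nonneg _ _) (hΦ0 y)) (Real.rpow_nonneg hy.1.le _)
  rw [intervalIntegral.integral_const_mul] at h3
  have hδ2 : 0 < δ ^ 2 := by positivity
  rw [div_mul_eq_mul_div, le_div_iff₀ hδ2]
  nlinarith

end Local

lemma integrable_const_mul_ballApprox (hκ : 0 ≤ κ) (ρ : ℝ) (k : ℕ) :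
    Integrable (fun z => mehtaConst κ * ballApprox κ ρ k z) (dunklMeasure κ) :=
  (integrable_ballApprox hκ ρ k).const_mul _

lemma continuous_ballWave (hκ : 0 ≤ κ) (ρ : ℝ) (k : ℕ) (x : ℝ) :
    Continuous fun y => ballWave κ ρ k x y := by
  have hw := integrable_const_mul_ballApprox hκ ρ k
  exact ((continuous_waveEven hκ hw).comp (f := fun y : ℝ => (x, y)) (by fun_prop)).sub
    ((continuous_waveOdd hκ hw).comp (f := fun y : ℝ => (x, y)) (by fun_prop))

lemma eLpNorm_ballWave_sub_one (hκ : 0 ≤ κ) (ρ : ℝ) (k : ℕ) (x r : ℝ) :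
    eLpNorm ((fun y => (ballWave κ ρ k x y : ℂ)) - 1) 2 ((dunklMeasure κ).restrict (Icc (-r) r)) =
      ENNReal.ofReal (√(∫ y in Icc (-r) r, (ballWave κ ρ k x y - 1) ^ 2 ∂dunklMeasure κ)) := by
  have := isLocallyFiniteMeasure_dunklMeasure hκ
  have hc : Continuous ((fun y => (ballWave κ ρ k x y : ℂ)) - 1) :=
    (Complex.continuous_ofReal.comp (continuous_ballWave hκ ρ k x)).sub continuous_const
  rw [eLpNorm_two_eq_ofReal_sqrt]
  · congr 3 with y
    rw [Pi.sub_apply, Pi.one_apply, ← Complex.ofReal_one, ← Complex.ofReal_sub, Complex.norm_real,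
      Real.norm_eq_abs, sq_abs]
  · rw [memLp_two_iff_integrable_sq_norm hc.aestronglyMeasurable]
    exact (hc.norm.pow 2).continuousOn.integrableOn_compact isCompact_Icc

/-- `τ_0` is the identity, and the indicator of the ball is `1` on the closed interval except at its
two endpoints, a null set. -/
lemma tendsto_ballWave_zero (hκ : 0 ≤ κ) (ρ : ℝ) :
    Tendsto (fun k => ∫ y in Icc (-ρ) ρ, (ballWave κ ρ k 0 y - 1) ^ 2 ∂dunklMeasure κ)
      atTop (𝓝 0) := by
  have h := tendsto_ballWave hκ ρ 0
  have h1 : ∀ k, eLpNorm ((fun y => (ballWave κ ρ k 0 y : ℂ)) - 1) 2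
      ((dunklMeasure κ).restrict (Icc (-ρ) ρ)) ≤ eLpNorm ((fun y => (ballWave κ ρ k 0 y : ℂ)) -
      dunklTranslation κ 0 (ballIndicator ρ)) 2 (dunklMeasure κ) := by
    intro k
    refine le_trans (le_of_eq (eLpNorm_congr_ae (EventuallyEq.sub EventuallyEq.rfl ?_)))
      (eLpNorm_mono_measure _ Measure.restrict_le_self)
    have h2 : ∀ᵐ y ∂dunklMeasure κ, y ≠ -ρ ∧ y ≠ ρ := by
      have : ∀ a : ℝ, ∀ᵐ y ∂dunklMeasure κ, y ≠ a := fun a => by simp [ae_iff]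
      exact (this _).and (this _)
    filter_upwards [ae_restrict_of_ae (dunklTranslation_zero hκ (memLp_ballIndicator hκ ρ 2)),
      ae_restrict_of_ae h2, ae_restrict_mem measurableSet_Icc] with y h3 h4 h5
    rw [h3, Pi.one_apply, ballIndicator, indicator_of_mem, Pi.one_apply]
    rw [mem_ball_zero_iff, Real.norm_eq_abs, abs_lt]
    exact ⟨lt_of_le_of_ne h5.1 h4.1.symm, lt_of_le_of_ne h5.2 h4.2⟩
  have h2 := tendsto_of_tendsto_of_tendsto_of_le_of_le tendsto_const_nhds h (fun _ => zero_le) h1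
  simp only [eLpNorm_ballWave_sub_one hκ] at h2
  have h3 := (ENNReal.tendsto_toReal ENNReal.zero_ne_top).comp h2
  have h4 := h3.pow 2
  simp only [Function.comp_def, ENNReal.toReal_ofReal (Real.sqrt_nonneg _), ENNReal.toReal_zero,
    ne_eq, OfNat.ofNat_ne_zero, not_false_eq_true, zero_pow] at h4
  refine h4.congr fun k => Real.sq_sqrt (integral_nonneg fun y => sq_nonneg _)

/-- Propagate from time `0` to time `|x|` with cutoff radius `R = ρ`: the error on the smaller ball
is at most `4 ρ² / δ²` times the initial error on the ball of radius `ρ`, uniformly in `k`. -/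
lemma tendsto_ballWave_local (hκ : 0 ≤ κ) {ρ r δ : ℝ} (x : ℝ) (hr : 0 ≤ r) (hδ : 0 < δ)
    (hρ : r + |x| + δ ≤ ρ) :
    Tendsto (fun k => ∫ y in Icc (-r) r, (ballWave κ ρ k x y - 1) ^ 2 ∂dunklMeasure κ)
      atTop (𝓝 0) := by
  have hx := abs_nonneg x
  have hρ0 : 0 ≤ ρ := by linarith
  have h := (tendsto_ballWave_zero hκ ρ).const_mul (4 / δ ^ 2 * ρ ^ 2)
  rw [mul_zero] at h
  refine tendsto_of_tendsto_of_tendsto_of_le_of_le tendsto_const_nhds h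
    (fun k => integral_nonneg fun y => sq_nonneg _) fun k => ?_
  have hw := integrable_const_mul_ballApprox hκ ρ k
  have hw1 : Integrable (fun z => z * (mehtaConst κ * ballApprox κ ρ k z)) (dunklMeasure κ) :=
    ((integrable_mul_ballApprox hκ ρ k).const_mul (mehtaConst κ)).congr
      (Eventually.of_forall fun z => by ring)
  have h0 : ∀ y, ballWave κ ρ k 0 y =
      waveEven κ (fun z => mehtaConst κ * ballApprox κ ρ k z) 0 y := fun y => by
    rw [ballWave, waveOdd_zero_left hκ, sub_zero]
  simp only [h0]
  calc _ ≤ 4 / δ ^ 2 * waveEnergy κ _ ρ |x| := setIntegral_sub_one_sq_le hκ hw x hr hδ hρ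
    _ ≤ 4 / δ ^ 2 * (ρ ^ 2 * _) := by
        refine mul_le_mul_of_nonneg_left ?_ (by positivity)
        exact (waveEnergy_le_waveEnergy_zero hκ hw hw1 hρ0 hx).trans
          (waveEnergy_zero_le hκ hw hρ0)
    _ = _ := by ring

/-- The Dunkl translate of the indicator function of the ball of radius `ρ` is `1` on the ball of
radius `ρ - |x|`. -/
lemma dunklTranslation_ballIndicator_eq_one (hκ : 0 ≤ κ) (ρ x : ℝ) :
    ∀ᵐ y ∂dunklMeasure κ, |y| < ρ - |x| → dunklTranslation κ x (ballIndicator ρ) y = 1 := by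
  have hτ := memLp_dunklTranslation hκ x (memLp_ballIndicator hκ ρ 2)
  have key : ∀ r δ : ℝ, 0 ≤ r → 0 < δ → r + |x| + δ ≤ ρ →
      ∀ᵐ y ∂(dunklMeasure κ).restrict (Icc (-r) r),
        dunklTranslation κ x (ballIndicator ρ) y = 1 := by
    intro r δ hr hδ hρ
    set ν := (dunklMeasure κ).restrict (Icc (-r) r)
    have h1 : Tendsto (fun k => eLpNorm ((fun y => (ballWave κ ρ k x y : ℂ)) - 1) 2 ν) atTop
        (𝓝 0) := by
      simp only [ν, eLpNorm_ballWave_sub_one hκ]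
      have := (ENNReal.continuous_ofReal.comp Real.continuous_sqrt).tendsto 0
      simp only [Function.comp_def, Real.sqrt_zero, ENNReal.ofReal_zero] at this
      exact this.comp (tendsto_ballWave_local hκ x hr hδ hρ)
    have h2 : Tendsto (fun k => eLpNorm ((fun y => (ballWave κ ρ k x y : ℂ)) -
        dunklTranslation κ x (ballIndicator ρ)) 2 ν) atTop (𝓝 0) :=
      tendsto_of_tendsto_of_tendsto_of_le_of_le tendsto_const_nhds (tendsto_ballWave hκ ρ x)
        (fun _ => zero_le) fun k => eLpNorm_mono_measure _ Measure.restrict_le_self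
    -- The regularized waves tend both to `1` and to the translate in `L²` of the interval, so these
    -- limits agree.
    have h3 := h1.add h2
    rw [add_zero] at h3
    have hm : ∀ k, AEStronglyMeasurable (fun y => (ballWave κ ρ k x y : ℂ)) ν := fun k =>
      (Complex.continuous_ofReal.comp (continuous_ballWave hκ ρ k x)).aestronglyMeasurable
    have hm' : AEStronglyMeasurable (dunklTranslation κ x (ballIndicator ρ)) ν :=
      hτ.aestronglyMeasurable.restrict
    have h4 : eLpNorm (dunklTranslation κ x (ballIndicator ρ) - 1) 2 ν ≤ 0 := by
      refine ge_of_tendsto' h3 fun k => ?_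
      have e : dunklTranslation κ x (ballIndicator ρ) - 1 =
          ((fun y => (ballWave κ ρ k x y : ℂ)) - 1) - ((fun y => (ballWave κ ρ k x y : ℂ)) -
            dunklTranslation κ x (ballIndicator ρ)) := by abel
      rw [e]
      exact eLpNorm_sub_le ((hm k).sub aestronglyMeasurable_const) ((hm k).sub hm') one_le_two
    rw [nonpos_iff_eq_zero, eLpNorm_eq_zero_iff (hm'.sub aestronglyMeasurable_one)
      two_ne_zero] at h4
    filter_upwards [h4] with y hy
    exact sub_eq_zero.1 hy
  -- The energy argument needs a positive margin; margins `1 / (m + 1)` exhaust the open ball up to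
  -- countably many null sets.
  have h : ∀ᵐ y ∂dunklMeasure κ, ∀ m : ℕ, |y| ≤ ρ - |x| - 1 / ((m : ℝ) + 1) →
      dunklTranslation κ x (ballIndicator ρ) y = 1 := by
    rw [ae_all_iff]
    intro m
    rcases lt_or_ge (ρ - |x| - 1 / ((m : ℝ) + 1)) 0 with hneg | hpos
    · exact Eventually.of_forall fun y hy => absurd (abs_nonneg y) (by linarith)
    · have := key _ (1 / ((m : ℝ) + 1)) hpos (by positivity) (by linarith)
      rw [ae_restrict_iff' measurableSet_Icc] at this
      filter_upwards [this] with y hy hy'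
      exact hy (abs_le.1 hy')
  filter_upwards [h] with y hy hlt
  obtain ⟨m, hm⟩ := exists_nat_one_div_lt (sub_pos.2 hlt)
  exact hy m (by linarith)

end

/-! ### Lower bounds for the maximal function -/

lemma dunklMeasure_Ico {κ : ℝ} (hκ : 0 ≤ κ) {a b : ℝ} (ha : 0 ≤ a) (hab : a ≤ b) :
    dunklMeasure κ (Ico a b) =
      ENNReal.ofReal ((b ^ (2 * κ + 1) - a ^ (2 * κ + 1)) / (2 * κ + 1)) := by
  have := isLocallyFiniteMeasure_dunklMeasure hκ
  have h := setIntegral_dunklMeasure (κ := κ) (measurableSet_Ico (a := a) (b := b)) (fun _ => 1)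
  rw [setIntegral_const, smul_eq_mul, mul_one, integral_Ico_eq_integral_Ioc,
    ← intervalIntegral.integral_of_le hab] at h
  have h2 : ∫ y in a..b, |y| ^ (2 * κ) * 1 = ∫ y in a..b, y ^ (2 * κ) := by
    refine intervalIntegral.integral_congr fun y hy => ?_
    rw [uIcc_of_le hab] at hy
    rw [abs_of_nonneg (ha.trans hy.1), mul_one]
  rw [h2, integral_rpow (Or.inl (by linarith))] at h
  rw [← h, ofReal_measureReal (measure_Ico_lt_top).ne]

lemma dunklMeasure_ball {κ : ℝ} (hκ : 0 ≤ κ) {r : ℝ} (hr : 0 ≤ r) :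
    dunklMeasure κ (Metric.ball 0 r) =
      ENNReal.ofReal (2 * r ^ (2 * κ + 1) / (2 * κ + 1)) := by
  have := isLocallyFiniteMeasure_dunklMeasure hκ
  have h := setIntegral_Icc_of_even hκ (continuous_const (y := (1 : ℝ))) (fun _ => rfl) hr
  rw [setIntegral_const, smul_eq_mul, mul_one] at h
  simp only [one_mul] at h
  rw [integral_rpow (Or.inl (by linarith)), Real.zero_rpow (by linarith), sub_zero,
    ← mul_div_assoc] at h
  rw [Real.ball_eq_Ioo, zero_sub, zero_add, measure_congr Ioo_ae_eq_Icc, ← h,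
    ofReal_measureReal (isCompact_Icc.measure_lt_top).ne]

/-- The maximal function of a bounded function near the origin. -/
lemma le_dunklMaximal_indicator {κ : ℝ} (hκ : 0 ≤ κ) {s : Set ℝ} (hs : MeasurableSet s)
    {ρ x : ℝ} (hρ : 0 < ρ) (hsub : ∀ y ∈ s, |y| < ρ - |x|) :
    (dunklMeasure κ (Metric.ball 0 ρ))⁻¹ * dunklMeasure κ s ≤
      dunklMaximal κ (s.indicator 1) x := by
  have := isLocallyFiniteMeasure_dunklMeasure hκ
  have hfin : dunklMeasure κ s ≠ ⊤ := by
    refine ne_top_of_le_ne_top (measure_ball_lt_top (x := (0 : ℝ)) (r := ρ)).ne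
      (measure_mono fun y hy => ?_)
    rw [mem_ball_zero_iff, Real.norm_eq_abs]
    linarith [hsub y hy, abs_nonneg x]
  have h : ∫ y : ℝ, s.indicator (1 : ℝ → ℂ) y *
      dunklTranslation κ x ((Metric.ball (0 : ℝ) ρ).indicator 1) (-y) ∂dunklMeasure κ =
      ((dunklMeasure κ).real s : ℂ) := by
    have h1 : ∫ y, s.indicator (1 : ℝ → ℂ) y ∂dunklMeasure κ = ((dunklMeasure κ).real s : ℂ) := by
      rw [integral_indicator hs]
      simp
    rw [← h1]
    refine integral_congr_ae ?_
    filter_upwards [ae_neg_of_ae (dunklTranslation_ballIndicator_eq_one hκ ρ x)] with y hy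
    by_cases hys : y ∈ s
    · have := hy (by rw [abs_neg]; exact hsub y hys)
      rw [ballIndicator] at this
      rw [this, mul_one]
    · simp [hys]
  unfold dunklMaximal
  -- Keep only the radius `ρ` in the supremum.
  refine le_trans (le_of_eq ?_) (le_iSup₂ (f := fun (ρ : ℝ) (_ : 0 < ρ) => _) ρ hρ)
  rw [h, ← ofReal_norm, Complex.norm_real, Real.norm_of_nonneg measureReal_nonneg,
    ofReal_measureReal hfin]

/-- Radius `2 ^ (n + 1)` works because `2 ^ (n + 1) - |x| ≥ 2 ^ n`, which exceeds every point of the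
block. The factors `2 ^ (n (2κ + 1))` cancel in the ratio of measures, leaving the stated constant.
-/
lemma le_dunklMaximal_dyadicSeq {κ : ℝ} (hκ : 0 ≤ κ) (n : ℕ+) {x : ℝ}
    (hx : |x| ≤ (2 : ℝ) ^ (n : ℕ)) :
    ENNReal.ofReal ((1 - (2 : ℝ) ^ (-(2 * κ + 1))) / (2 : ℝ) ^ (2 * κ + 2)) ≤
      dunklMaximal κ (dyadicSeq n) x := by
  obtain ⟨m, hm⟩ : ∃ m : ℕ, (n : ℕ) = m + 1 := Nat.exists_eq_succ_of_ne_zero n.ne_zero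
  have hle : (2 : ℝ) ^ m ≤ 2 ^ (m + 1) := pow_le_pow_right₀ one_le_two (Nat.le_succ m)
  have h := le_dunklMaximal_indicator hκ (measurableSet_Ico (a := (2 : ℝ) ^ m) (b := 2 ^ (m + 1)))
    (ρ := 2 ^ (m + 2)) (x := x) (by positivity) (fun y hy => by
      have h1 : 0 < y := lt_of_lt_of_le (by positivity) hy.1
      rw [hm] at hx
      have h2 := hy.2
      rw [abs_of_pos h1]
      have h3 : (2 : ℝ) ^ (m + 2) = 2 ^ (m + 1) + 2 ^ (m + 1) := by ring
      linarith)
  rw [dyadicSeq, hm, Nat.add_sub_cancel]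
  refine le_trans (le_of_eq ?_) h
  have h2 : (0 : ℝ) < 2 ^ (2 * κ + 1) := by positivity
  have hp : ∀ j : ℕ, ((2 : ℝ) ^ j) ^ (2 * κ + 1) = (2 ^ (2 * κ + 1)) ^ j := fun j => by
    rw [← Real.rpow_natCast, ← Real.rpow_mul zero_le_two, mul_comm, Real.rpow_mul zero_le_two,
      Real.rpow_natCast]
  rw [dunklMeasure_Ico hκ (by positivity) hle, dunklMeasure_ball hκ (by positivity), hp, hp, hp,
    ← ENNReal.ofReal_inv_of_pos (by positivity), ← ENNReal.ofReal_mul (by positivity)]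
  congr 1
  rw [Real.rpow_neg zero_le_two, show 2 * κ + 2 = (2 * κ + 1) + 1 by ring,
    Real.rpow_add_one two_ne_zero (2 * κ + 1)]
  field_simp
  ring

lemma dyadicLowerBound_pos {κ : ℝ} (hκ : 0 ≤ κ) :
    0 < (1 - (2 : ℝ) ^ (-(2 * κ + 1))) / (2 : ℝ) ^ (2 * κ + 2) := by
  have : (2 : ℝ) ^ (-(2 * κ + 1)) < 1 := Real.rpow_lt_one_of_one_lt_of_neg one_lt_two (by linarith)
  have h2 : (0 : ℝ) < 2 ^ (2 * κ + 2) := by positivity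
  exact div_pos (by linarith) h2

/-! ### The dyadic sequence and its `ℓ^r` norms -/

lemma exists_pnat_mem_dyadic {x : ℝ} (hx : 1 ≤ x) :
    ∃ n : ℕ+, x ∈ Ico ((2 : ℝ) ^ ((n : ℕ) - 1)) ((2 : ℝ) ^ (n : ℕ)) := by
  obtain ⟨m, h1, h2⟩ := exists_nat_pow_near hx one_lt_two
  exact ⟨⟨m + 1, Nat.succ_pos m⟩, by simpa using h1, by simpa using h2⟩

lemma eq_of_mem_dyadic {x : ℝ} {m n : ℕ+}
    (hm : x ∈ Ico ((2 : ℝ) ^ ((m : ℕ) - 1)) ((2 : ℝ) ^ (m : ℕ)))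
    (hn : x ∈ Ico ((2 : ℝ) ^ ((n : ℕ) - 1)) ((2 : ℝ) ^ (n : ℕ))) : m = n := by
  have h1 : (m : ℕ) - 1 < n := (pow_lt_pow_iff_right₀ one_lt_two).1 (hm.1.trans_lt hn.2)
  have h2 : (n : ℕ) - 1 < m := (pow_lt_pow_iff_right₀ one_lt_two).1 (hn.1.trans_lt hm.2)
  have := m.pos
  have := n.pos
  exact PNat.eq (by omega)

lemma seqNorm_dyadicSeq {r : ℝ} (hr : 0 < r) (x : ℝ) :
    seqNorm r dyadicSeq x = (Ici (1 : ℝ)).indicator 1 x := by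
  unfold seqNorm lrNorm
  by_cases hx : 1 ≤ x
  · obtain ⟨n, hn⟩ := exists_pnat_mem_dyadic hx
    rw [tsum_eq_single n, indicator_of_mem (mem_Ici.2 hx)]
    · simp [dyadicSeq, indicator_of_mem hn]
    · intro m hm
      have h0 : dyadicSeq m x = 0 := indicator_of_notMem (fun h => hm (eq_of_mem_dyadic h hn)) _
      simp [h0, hr]
  · have h0 : ∀ n, dyadicSeq n x = 0 := fun n =>
      indicator_of_notMem (fun h => hx ((one_le_pow₀ one_le_two).trans h.1)) _
    rw [indicator_of_notMem (by simpa using hx)]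
    simp [h0, hr]

lemma memLp_seqNorm_dyadicSeq (κ : ℝ) {r : ℝ} (hr : 0 < r) :
    MemLp (seqNorm r dyadicSeq) ⊤ (dunklMeasure κ) := by
  have e : seqNorm r dyadicSeq = (Ici (1 : ℝ)).indicator 1 := funext (seqNorm_dyadicSeq hr)
  rw [e]
  refine ⟨(measurable_one.indicator measurableSet_Ici).aestronglyMeasurable, ?_⟩
  refine lt_of_le_of_lt (eLpNormEssSup_le_of_ae_enorm_bound (C := 1)
    (Eventually.of_forall fun x => ?_)) ENNReal.one_lt_top
  by_cases h : x ∈ Ici (1 : ℝ) <;> simp [h]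

/-- Once `2 ^ n ≥ |x|` every term is bounded below by the same positive constant, so the series
diverges. -/
lemma seqMaximalNorm_dyadicSeq {κ : ℝ} (hκ : 0 ≤ κ) {r : ℝ} (hr : 0 < r) (x : ℝ) :
    seqMaximalNorm κ r dyadicSeq x = ⊤ := by
  set c := ENNReal.ofReal ((1 - (2 : ℝ) ^ (-(2 * κ + 1))) / (2 : ℝ) ^ (2 * κ + 2))
  have hc : c ≠ 0 := (ENNReal.ofReal_pos.2 (dyadicLowerBound_pos hκ)).ne'
  obtain ⟨N, hN⟩ := pow_unbounded_of_one_lt |x| one_lt_two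
  have h : (⊤ : ℝ≥0∞) ≤ ∑' n : ℕ+, dunklMaximal κ (dyadicSeq n) x ^ r := by
    have h1 : ∑' _ : ℕ, c ^ r = ⊤ := ENNReal.tsum_const_eq_top_of_ne_zero
      (by simp [ENNReal.rpow_eq_zero_iff, hc, hr.le])
    rw [← h1]
    -- The tail of indices beyond `N` already carries an infinite constant series.
    have hinj : Function.Injective fun k : ℕ => (⟨N + k + 1, Nat.succ_pos _⟩ : ℕ+) := by
      intro a b hab
      have := congrArg PNat.val hab
      simp only [PNat.mk_coe] at this
      omega
    refine le_trans (ENNReal.tsum_le_tsum fun k => ?_) (ENNReal.tsum_comp_le_tsum_of_injective hinj _)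
    refine ENNReal.rpow_le_rpow (le_dunklMaximal_dyadicSeq hκ _ ?_) hr.le
    refine hN.le.trans (pow_le_pow_right₀ one_le_two ?_)
    simp only [PNat.mk_coe]
    omega
  unfold seqMaximalNorm lrNorm
  rw [top_le_iff.1 h, ENNReal.top_rpow_of_pos (by positivity)]

end Dunkl
end

theorem mainTheorem3 (κ : ℝ) (hκ : 0 ≤ κ) (r : ℝ) (hr : 1 < r) :
    -- the sequence is bounded in `ℓ^r`
    (∀ x : ℝ, Dunkl.seqNorm r Dunkl.dyadicSeq x = (Set.Ici (1 : ℝ)).indicator 1 x) ∧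
    MemLp (Dunkl.seqNorm r Dunkl.dyadicSeq) ⊤ (Dunkl.dunklMeasure κ) ∧
    -- the lower bound for the maximal functions
    (∀ (n : ℕ+) (x : ℝ), |x| ≤ (2 : ℝ) ^ (n : ℕ) →
      ENNReal.ofReal ((1 - (2 : ℝ) ^ (-(2 * κ + 1))) / (2 : ℝ) ^ (2 * κ + 2)) ≤
        Dunkl.dunklMaximal κ (Dunkl.dyadicSeq n) x) ∧
    -- the maximal sequence is not in `L^∞(ℓ^r)`
    (∀ x : ℝ, Dunkl.seqMaximalNorm κ r Dunkl.dyadicSeq x = ⊤) ∧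
    eLpNorm (Dunkl.seqMaximalNorm κ r Dunkl.dyadicSeq) ⊤ (Dunkl.dunklMeasure κ) = ⊤ ∧
    -- the vector-valued maximal inequality fails for `p = ∞`
    ¬ ∃ C : ℝ≥0, ∀ f : ℕ+ → ℝ → ℂ, (∀ n, Measurable (f n)) →
      MemLp (Dunkl.seqNorm r f) ⊤ (Dunkl.dunklMeasure κ) →
      eLpNorm (Dunkl.seqMaximalNorm κ r f) ⊤ (Dunkl.dunklMeasure κ) ≤
        C * eLpNorm (Dunkl.seqNorm r f) ⊤ (Dunkl.dunklMeasure κ) := by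
  have hr0 : 0 < r := by linarith
  have hM := Dunkl.seqMaximalNorm_dyadicSeq hκ hr0
  have hmem := Dunkl.memLp_seqNorm_dyadicSeq κ hr0
  have htop : eLpNorm (Dunkl.seqMaximalNorm κ r Dunkl.dyadicSeq) ⊤ (Dunkl.dunklMeasure κ) = ⊤ := by
    rw [funext hM, eLpNorm_const _ ENNReal.top_ne_zero Dunkl.dunklMeasure_ne_zero]
    simp
  refine ⟨Dunkl.seqNorm_dyadicSeq hr0, hmem, fun n x hx => Dunkl.le_dunklMaximal_dyadicSeq hκ n hx,
    hM, htop, ?_⟩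
  -- For the dyadic sequence the inequality would bound `⊤` by a finite constant times a finite
  -- norm.
  rintro ⟨C, hC⟩
  have h := hC Dunkl.dyadicSeq (fun n => measurable_one.indicator measurableSet_Ico) hmem
  rw [htop, top_le_iff] at h
  exact ENNReal.mul_ne_top ENNReal.coe_ne_top hmem.2.ne h
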